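/- All algebras are over $\mathbb{C}$, associative and unital, and the co-products, co-units and co-actions below are algebra homomorphisms defined by the given values on generators, except for the linear map $\delta^\alpha$. **Series side.** Let $\mathbb{C}(G^{\mathrm{dif}})=\mathbb{C}[a_1,a_2,\dots]$ be the polynomial ring, with $a_0:=1$, $A(x)=\sum_{n\ge0}a_nx^{n+1}$, and let $\Delta^{\mathrm{dif}}a_n$ be the coefficient of $x^{n+1}$ in $\sum_{k\ge0}a_k\otimes A(x)^{k+1}$, $\varepsilon(a_n)=0$ for $n\ge1$. Let $\mathcal{H}^{\mathrm{inv}}=\mathbb{C}\langle b_1,b_2,\dots\rangle$ be the free algebra, with $b_0:=1$, $\Delta^{\mathrm{inv}}b_n=\sum_{k=0}^n b_k\otimes b_{n-k}$, $\varepsilon(b_n)=0$ for $n\ge1$. Let $\delta^{\mathrm{dif}}:\mathcal{H}^{\mathrm{inv}}\to\mathcal{H}^{\mathrm{inv}}\otimes\mathbb{C}(G^{\mathrm{dif}})$ be such that $\delta^{\mathrm{dif}}b_n$ is the coefficient of $x^n$ in $\sum_{k\ge0}b_k\otimes A(x)^k$. **Tree side.** Let $Y_\infty$ be the set of rooted planar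 binary trees, $|$ the root tree, $|t|$ the number of internal vertices of $t$, $r\vee s$ the grafting of $r$ (left) and $s$ (right) on a new root, $V(s)=|\vee s$, and $t/s$ the grafting of the root of $t$ on the left-most leaf of $s$. Let $\widetilde{\mathcal H}^\alpha$ be the vector space spanned by $Y_\infty$, with product $/$ and unit $|$. Define linear maps $\Delta^\alpha,\delta^\alpha:\widetilde{\mathcal H}^\alpha\to\widetilde{\mathcal H}^\alpha\otimes\widetilde{\mathcal H}^\alpha$ by $\Delta^\alpha|=\delta^\alpha|=|\otimes|$ and $$\delta^\alpha V(s)=(V\otimes\mathrm{Id})\delta^\alpha(s),\quad \Delta^\alpha V(s)=|\otimes V(s)+\delta^\alpha V(s),\quad \Delta^\alpha(r\vee s)=\Delta^\alpha r/\Delta^\alpha V(s),\quad \delta^\alpha(r\vee s)=\Delta^\alpha r/\delta^\alpha V(s).$$ Let $\mathcal H^\alpha=\mathbb{C}[V(s),\,s\in Y_\infty]$ be the Abelianisation of $\widetilde{\mathcal H}^\alpha$, with the co-product induced by $\Delta^\alpha$ and the co-unit vanishing on all trees $t\ne|$. Let $\mathcal H^e=\mathbb{C}\langle Y_\infty\rangle/(|-1)$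 be the free algebra on trees with $|$ identified with $1$; its co-product is given on trees by $\Delta^p_e|=|\otimes|$, $\Delta^p_e(r\vee s)=|\otimes(r\vee s)+\sum(r\vee s_{(1)})\otimes s_{(2)}$, where $\Delta^p_e(s)=\sum s_{(1)}\otimes s_{(2)}$ is a sum of tensors of trees; its co-unit vanishes on all trees $t\ne|$. Let $\delta^e:\mathcal H^e\to\mathcal H^e\otimes\mathcal H^\alpha$ be the multiplicative extension of $\delta^\alpha$ (on a tree $t$, $\delta^e(t)$ is $\delta^\alpha(t)$ with its left factors read as elements of $\mathcal H^e$ and its right factors as elements of $\mathcal H^\alpha$). Put $t_n=\sum_{|t|=n}t$. **Semi-direct co-product.** For a commutative algebra $H$ with co-product $\Delta_H$ and co-unit $\varepsilon_H$, an algebra $B$ with co-product $\Delta_B$ and co-unit $\varepsilon_B$, and $\delta:B\to B\otimes H$, let $H\ltimes B$ be the algebra $H\otimes B$ with $\Delta(a\otimes b)=\Delta_H(a)\,[(\delta\otimes\mathrm{Id})\Delta_B(b)]$, where $b'\otimes h\otimes b''\in B\otimes H\otimes B$ is read as $(1\otimes b')\otimes(h\otimes b'')$ and $a_1\otimes a_2\in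 H\otimes H$ as $(a_1\otimes1)\otimes(a_2\otimes1)$, and with co-unit $\varepsilon_H\otimes\varepsilon_B$. **Corollary 4.3.** There are injective algebra homomorphisms $\Omega:\mathbb{C}(G^{\mathrm{dif}})\to\mathcal H^\alpha$, $a_n\mapsto t_n$, and $j:\mathcal H^{\mathrm{inv}}\to\mathcal H^e$, $b_n\mapsto t_n$ $(n\ge0)$, which respect the co-products and the co-units and are compatible with the co-actions: $\delta^e\circ j=(j\otimes\Omega)\circ\delta^{\mathrm{dif}}$. Moreover $\mathbb{C}(G^{\mathrm{dif}})\ltimes\mathcal H^{\mathrm{inv}}$ (with $\delta^{\mathrm{dif}}$) and the QED renormalization Hopf algebra $\mathcal H^\alpha\ltimes\mathcal H^e$ (with $\delta^e$) are Hopf algebras, and the map $a\otimes b\mapsto\Omega(a)\otimes j(b)$ is an injective homomorphism of bi-algebras from the first to the second which commutes with the antipodes. Thus $\mathbb{C}(G^{\mathrm{dif}})\ltimes\mathcal H^{\mathrm{inv}}$ is a Hopf sub-algebra of $\mathcal H^\alpha\ltimes\mathcal H^e$. -/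

import Mathlib

open scoped TensorProduct
open Function

noncomputable section

namespace QEDHopf

/-! ### Hopf algebras presented by a co-product and a co-unit -/

/-- The algebra homomorphisms `Δ` and `ε` make the unital associative algebra `A` a Hopf algebra. -/
structure IsHopf {A : Type} [Semiring A] [Algebra ℂ A]
    (Δ : A →ₐ[ℂ] A ⊗[ℂ] A) (ε : A →ₐ[ℂ] ℂ) : Prop where
  coassoc : (Algebra.TensorProduct.assoc ℂ ℂ ℂ A A A).toAlgHom.comp
      ((Algebra.TensorProduct.map Δ (AlgHom.id ℂ A)).comp Δ) =
    (Algebra.TensorProduct.map (AlgHom.id ℂ A) Δ).comp Δ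
  rTensor : (Algebra.TensorProduct.map ε (AlgHom.id ℂ A)).comp Δ =
    (Algebra.TensorProduct.lid ℂ A).symm
  lTensor : (Algebra.TensorProduct.map (AlgHom.id ℂ A) ε).comp Δ =
    (Algebra.TensorProduct.rid ℂ ℂ A).symm
  exists_antipode : ∃ S : A →ₗ[ℂ] A,
    LinearMap.mul' ℂ A ∘ₗ S.rTensor A ∘ₗ Δ.toLinearMap = Algebra.linearMap ℂ A ∘ₗ ε.toLinearMap ∧
    LinearMap.mul' ℂ A ∘ₗ S.lTensor A ∘ₗ Δ.toLinearMap = Algebra.linearMap ℂ A ∘ₗ ε.toLinearMap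

/-- The Hopf algebra with underlying algebra `A`, co-product `Δ` and co-unit `ε` (its antipode is
uniquely determined by these). -/
@[reducible] def IsHopf.hopfAlgebra {A : Type} [Semiring A] [Algebra ℂ A]
    {Δ : A →ₐ[ℂ] A ⊗[ℂ] A} {ε : A →ₐ[ℂ] ℂ} (h : IsHopf Δ ε) : HopfAlgebra ℂ A :=
  { Bialgebra.ofAlgHom Δ ε h.coassoc h.rTensor h.lTensor with
    antipode := h.exists_antipode.choose
    mul_antipode_rTensor_comul := h.exists_antipode.choose_spec.1
    mul_antipode_lTensor_comul := h.exists_antipode.choose_spec.2 }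

/-! ### Semi-direct (smash) co-products

Here `H` is commutative with co-product `ΔH`, `B` has co-product `ΔB`, and `δ : B → B ⊗ H` is a
right co-action by an algebra homomorphism. -/

section Smash

variable {H B : Type} [CommRing H] [Algebra ℂ H] [Semiring B] [Algebra ℂ B]

/-- `a ↦ ∑ (a₁ ⊗ 1) ⊗ (a₂ ⊗ 1)`, where `ΔH a = ∑ a₁ ⊗ a₂`. -/
def smashLeft (ΔH : H →ₐ[ℂ] H ⊗[ℂ] H) : H →ₐ[ℂ] (H ⊗[ℂ] B) ⊗[ℂ] (H ⊗[ℂ] B) :=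
  (Algebra.TensorProduct.map Algebra.TensorProduct.includeLeft
    Algebra.TensorProduct.includeLeft).comp ΔH

/-- `b ↦ (δ ⊗ Id) (ΔB b)`, whose value in `B ⊗ H ⊗ B` is read in `(H ⊗ B) ⊗ (H ⊗ B)` through
`b' ⊗ h ⊗ b'' ↦ (1 ⊗ b') ⊗ (h ⊗ b'')`. -/
def smashRight (ΔB : B →ₐ[ℂ] B ⊗[ℂ] B) (δ : B →ₐ[ℂ] B ⊗[ℂ] H) :
    B →ₐ[ℂ] (H ⊗[ℂ] B) ⊗[ℂ] (H ⊗[ℂ] B) :=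
  ((Algebra.TensorProduct.map Algebra.TensorProduct.includeRight (AlgHom.id ℂ (H ⊗[ℂ] B))).comp
    (Algebra.TensorProduct.assoc ℂ ℂ ℂ B H B).toAlgHom).comp
    ((Algebra.TensorProduct.map δ (AlgHom.id ℂ B)).comp ΔB)

theorem smash_commute (ΔH : H →ₐ[ℂ] H ⊗[ℂ] H) (ΔB : B →ₐ[ℂ] B ⊗[ℂ] B) (δ : B →ₐ[ℂ] B ⊗[ℂ] H)
    (a : H) (b : B) : Commute (smashLeft (B := B) ΔH a) (smashRight ΔB δ b) := by
  have key : ∀ (x : H ⊗[ℂ] H) (y : (H ⊗[ℂ] B) ⊗[ℂ] (H ⊗[ℂ] B)),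
      Commute (Algebra.TensorProduct.map (Algebra.TensorProduct.includeLeft : H →ₐ[ℂ] H ⊗[ℂ] B)
        (Algebra.TensorProduct.includeLeft : H →ₐ[ℂ] H ⊗[ℂ] B) x) y := by
    have h1 : ∀ (u : H) (v : H ⊗[ℂ] B), Commute (u ⊗ₜ[ℂ] (1 : B)) v := by
      intro u v
      induction v with
      | zero => exact Commute.zero_right _
      | tmul p q => simp [commute_iff_eq, mul_comm u p]
      | add p q hp hq => exact hp.add_right hq
    intro x y
    induction x with
    | zero => simp
    | add p q hp hq => rw [map_add]; exact hp.add_left hq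
    | tmul u v =>
      induction y with
      | zero => exact Commute.zero_right _
      | tmul p q => simp [commute_iff_eq, (h1 u p).eq, (h1 v q).eq]
      | add p q hp hq => exact hp.add_right hq
  exact key _ _

/-- The co-product of the semi-direct co-product `H ⋉ B`, whose underlying algebra is `H ⊗ B`:
`Δ (a ⊗ b) = ΔH a [(δ ⊗ Id) (ΔB b)]`. -/
def smashComul (ΔH : H →ₐ[ℂ] H ⊗[ℂ] H) (ΔB : B →ₐ[ℂ] B ⊗[ℂ] B) (δ : B →ₐ[ℂ] B ⊗[ℂ] H) :
    H ⊗[ℂ] B →ₐ[ℂ] (H ⊗[ℂ] B) ⊗[ℂ] (H ⊗[ℂ] B) :=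
  Algebra.TensorProduct.lift (smashLeft ΔH) (smashRight ΔB δ) (smash_commute ΔH ΔB δ)

/-- The co-unit `a ⊗ b ↦ εH a * εB b` of `H ⋉ B`. -/
def smashCounit (εH : H →ₐ[ℂ] ℂ) (εB : B →ₐ[ℂ] ℂ) : H ⊗[ℂ] B →ₐ[ℂ] ℂ :=
  Algebra.TensorProduct.lift εH εB (fun _ _ => mul_comm _ _)

end Smash

/-! ### The co-ordinate ring of formal diffeomorphisms -/

/-- `ℂ(G^dif) = ℂ[a₁, a₂, …]`; the variable with index `n` is `a_{n+1}`. -/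
abbrev CGdif : Type := MvPolynomial ℕ ℂ

/-- The co-ordinate function `a_n`, with `a_0 = 1`. -/
def a : ℕ → CGdif
  | 0 => 1
  | n + 1 => MvPolynomial.X n

/-- The generating series `A(x) = ∑ a_n x^{n+1}`. -/
def seriesA : PowerSeries CGdif := PowerSeries.X * PowerSeries.mk a

/-- The co-product dual to composition of series: `Δ a_n` is the coefficient of `x^{n+1}` in
`Δ A(x) = ⟨z⁻¹⟩ A(z) ⊗ 1/(z - A(x)) = ∑_k a_k ⊗ A(x)^{k+1}`. -/
def difComul : CGdif →ₐ[ℂ] CGdif ⊗[ℂ] CGdif :=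
  MvPolynomial.aeval fun n => ∑ k ∈ Finset.range (n + 2),
    a k ⊗ₜ[ℂ] PowerSeries.coeff (n + 2) (seriesA ^ (k + 1))

/-- The co-unit: `a_n ↦ 0` for `n ≥ 1`. -/
def difCounit : CGdif →ₐ[ℂ] ℂ := MvPolynomial.aeval fun _ => 0

/-! ### The non-commutative Hopf algebra of invertible series -/

/-- `H^inv = ℂ⟨b₁, b₂, …⟩`; the generator with index `n` is `b_{n+1}`. -/
abbrev Hinv : Type := FreeAlgebra ℂ ℕ

/-- The generator `b_n`, with `b_0 = 1`. -/
def b : ℕ → Hinv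
  | 0 => 1
  | n + 1 => FreeAlgebra.ι ℂ n

/-- `Δ b_n = ∑_{k=0}^n b_k ⊗ b_{n-k}`. -/
def invComul : Hinv →ₐ[ℂ] Hinv ⊗[ℂ] Hinv :=
  FreeAlgebra.lift ℂ fun n => ∑ k ∈ Finset.range (n + 2), b k ⊗ₜ[ℂ] b (n + 1 - k)

/-- The co-unit: `b_n ↦ 0` for `n ≥ 1`. -/
def invCounit : Hinv →ₐ[ℂ] ℂ := FreeAlgebra.lift ℂ fun _ => 0

/-- The co-action of `ℂ(G^dif)` on `H^inv`: `δ b_n` is the coefficient of `x^n` in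
`δ B(x) = ⟨z⁻¹⟩ B(z) ⊗ 1/(z - A(x)) = ∑_k b_k ⊗ A(x)^k`. -/
def difCoaction : Hinv →ₐ[ℂ] Hinv ⊗[ℂ] CGdif :=
  FreeAlgebra.lift ℂ fun n => ∑ k ∈ Finset.range (n + 2),
    b k ⊗ₜ[ℂ] PowerSeries.coeff (n + 1) (seriesA ^ k)

/-! ### Planar binary trees -/

/-- Rooted planar binary trees, described by their internal vertices: `nil` is the root tree `|`
and `node () r s` is `r ∨ s`, the grafting of `r` (left) and `s` (right) on a new root. -/
abbrev PBT : Type := BinaryTree Unit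

/-- The tree `t` over `s`: the root of `t` is grafted on the left-most leaf of `s`. -/
def overProd (t : PBT) : PBT → PBT
  | .nil => t
  | .node _ r s => .node () (overProd t r) s

/-- Trees form a monoid under the over product, with unit the root tree. -/
instance overMonoid : Monoid PBT where
  mul := overProd
  one := .nil
  mul_assoc t u v := by
    change overProd (overProd t u) v = overProd t (overProd u v)
    induction v with
    | nil => rfl
    | node _ r s hr _ => simp [overProd, hr]
  one_mul t := by
    change overProd .nil t = t
    induction t with
    | nil => rfl
    | node _ r s hr _ => simp [overProd, hr]
  mul_one _ := rfl

/-- `V(t) = | ∨ t`. -/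
def V (t : PBT) : PBT := .node () .nil t

/-- The vector space spanned by all trees, with the over product. -/
abbrev TreeAlg : Type := MonoidAlgebra ℂ PBT

/-- A tree as a basis element. -/
def tree (t : PBT) : TreeAlg := MonoidAlgebra.of ℂ PBT t

/-- The linear map determined by its values on the basis of trees. -/
def linearExt {M : Type} [AddCommMonoid M] [Module ℂ M] (f : PBT → M) : TreeAlg →ₗ[ℂ] M :=
  (MonoidAlgebra.basis PBT ℂ).constr ℂ f

/-- `t_n`, the sum of all trees with `n` internal vertices. -/
def treeSum (n : ℕ) : TreeAlg := ∑ t ∈ BinaryTree.treesOfNumNodesEq n, tree t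

/-- The linear map `V ⊗ Id`. -/
def VTensorId : TreeAlg ⊗[ℂ] TreeAlg →ₗ[ℂ] TreeAlg ⊗[ℂ] TreeAlg :=
  TensorProduct.map (linearExt fun t => tree (V t)) LinearMap.id

/-- The pair `(Δ^α t, δ^α t)` for a tree `t`, by simultaneous recursion; see the recursive formulae
proved below for its two components. -/
def treeMaps : PBT → (TreeAlg ⊗[ℂ] TreeAlg) × (TreeAlg ⊗[ℂ] TreeAlg)
  | .nil => (tree .nil ⊗ₜ[ℂ] tree .nil, tree .nil ⊗ₜ[ℂ] tree .nil)
  | .node _ r s =>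
    ((treeMaps r).1 * (tree .nil ⊗ₜ[ℂ] tree (V s) + VTensorId (treeMaps s).2),
      (treeMaps r).1 * VTensorId (treeMaps s).2)

/-- The co-product `Δ^α` on trees. -/
def treeComul (t : PBT) : TreeAlg ⊗[ℂ] TreeAlg := (treeMaps t).1

/-- The co-action `δ^α` on trees. -/
def treeCoaction (t : PBT) : TreeAlg ⊗[ℂ] TreeAlg := (treeMaps t).2

theorem treeComul_nil : treeComul .nil = tree .nil ⊗ₜ[ℂ] tree .nil := rfl

theorem treeCoaction_nil : treeCoaction .nil = tree .nil ⊗ₜ[ℂ] tree .nil := rfl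

theorem tree_nil_tmul : tree .nil ⊗ₜ[ℂ] tree .nil = (1 : TreeAlg ⊗[ℂ] TreeAlg) := rfl

/-- `δ V(s) = (V ⊗ Id) δ s`. -/
theorem treeCoaction_V (s : PBT) : treeCoaction (V s) = VTensorId (treeCoaction s) := by
  rw [← one_mul (VTensorId _), ← tree_nil_tmul]; rfl

/-- `Δ V(s) = | ⊗ V(s) + δ V(s)`. -/
theorem treeComul_V (s : PBT) :
    treeComul (V s) = tree .nil ⊗ₜ[ℂ] tree (V s) + treeCoaction (V s) := by
  rw [treeCoaction_V, ← one_mul (_ + _), ← tree_nil_tmul]; rfl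

/-- `Δ (r ∨ s) = Δ r / Δ V(s)`. -/
theorem treeComul_node (r s : PBT) :
    treeComul (.node () r s) = treeComul r * treeComul (V s) := by
  rw [treeComul_V, treeCoaction_V]; rfl

/-- `δ (r ∨ s) = Δ r / δ V(s)`. -/
theorem treeCoaction_node (r s : PBT) :
    treeCoaction (.node () r s) = treeComul r * treeCoaction (V s) := by
  rw [treeCoaction_V]; rfl

/-- The co-product on trees dual to the under product: `Δ | = | ⊗ |` and
`Δ (r ∨ s) = | ⊗ (r ∨ s) + ∑ (r ∨ s₁) ⊗ s₂`, where `Δ s = ∑ s₁ ⊗ s₂`. -/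
def underComul : PBT → TreeAlg ⊗[ℂ] TreeAlg
  | .nil => tree .nil ⊗ₜ[ℂ] tree .nil
  | .node _ r s => tree .nil ⊗ₜ[ℂ] tree (.node () r s) +
      TensorProduct.map (linearExt fun t => tree (.node () r t)) LinearMap.id (underComul s)

/-! ### The charge renormalization Hopf algebra -/

/-- `H^α`, the Abelianisation of the algebra of trees with the over product. The latter is free on
the trees `V(s)`, so `H^α` is the polynomial ring in variables indexed by `s`, the variable with
index `s` being the class of `V(s)`. -/
abbrev Halpha : Type := MvPolynomial PBT ℂ

/-- The class of a tree in `H^α`, from the decomposition `r ∨ s = r / V(s)`. -/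
def treeClass : PBT → Halpha
  | .nil => 1
  | .node _ r s => treeClass r * MvPolynomial.X s

theorem treeClass_over (t s : PBT) : treeClass (overProd t s) = treeClass t * treeClass s := by
  induction s with
  | nil => simp [overProd, treeClass]
  | node _ r s hr _ => simp [overProd, treeClass, hr, mul_assoc]

/-- The projection of the algebra of trees onto its Abelianisation. -/
def toHalpha : TreeAlg →ₐ[ℂ] Halpha :=
  MonoidAlgebra.lift ℂ Halpha PBT
    { toFun := treeClass, map_one' := rfl, map_mul' := treeClass_over }

/-- The co-product of `H^α`, induced by the one on trees. -/
def alphaComul : Halpha →ₐ[ℂ] Halpha ⊗[ℂ] Halpha :=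
  MvPolynomial.aeval fun s => Algebra.TensorProduct.map toHalpha toHalpha (treeComul (V s))

/-- The co-unit of `H^α`, which vanishes on all the trees different from the root tree. -/
def alphaCounit : Halpha →ₐ[ℂ] ℂ := MvPolynomial.aeval fun _ => 0

/-! ### The electron propagator Hopf algebra -/

/-- `H^e`, the free associative algebra on all trees, with the root tree identified with `1`. -/
abbrev He : Type := FreeAlgebra ℂ {t : PBT // t ≠ .nil}

/-- A tree as an element of `H^e`: a generator, or the unit for the root tree. -/
def treeGen : PBT → He
  | .nil => 1
  | .node _ r s => FreeAlgebra.ι ℂ ⟨.node () r s, by simp⟩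

/-- The linear map from the span of all trees to `H^e`; it is not multiplicative. -/
def toHe : TreeAlg →ₗ[ℂ] He := linearExt treeGen

/-- The co-product of `H^e`: the multiplicative extension of the one dual to the under product. -/
def eComul : He →ₐ[ℂ] He ⊗[ℂ] He :=
  FreeAlgebra.lift ℂ fun t => TensorProduct.map toHe toHe (underComul t.1)

/-- The co-unit of `H^e`, which vanishes on all the generators. -/
def eCounit : He →ₐ[ℂ] ℂ := FreeAlgebra.lift ℂ fun _ => 0

/-- The co-action `δ^e` of `H^α` on `H^e`: the multiplicative extension of `δ^α`. -/
def eCoaction : He →ₐ[ℂ] He ⊗[ℂ] Halpha :=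
  FreeAlgebra.lift ℂ fun t => TensorProduct.map toHe toHalpha.toLinearMap (treeCoaction t.1)

/-! ### The two semi-direct co-products -/

/-- The algebra underlying `ℂ(G^dif) ⋉ H^inv`. -/
abbrev SeriesSmash : Type := CGdif ⊗[ℂ] Hinv

/-- The co-product of `ℂ(G^dif) ⋉ H^inv`. -/
def seriesComul : SeriesSmash →ₐ[ℂ] SeriesSmash ⊗[ℂ] SeriesSmash :=
  smashComul difComul invComul difCoaction

/-- The co-unit of `ℂ(G^dif) ⋉ H^inv`. -/
def seriesCounit : SeriesSmash →ₐ[ℂ] ℂ := smashCounit difCounit invCounit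

/-- The algebra underlying `H^α ⋉ H^e`. -/
abbrev QEDSmash : Type := Halpha ⊗[ℂ] He

/-- The co-product of `H^α ⋉ H^e`. -/
def qedComul : QEDSmash →ₐ[ℂ] QEDSmash ⊗[ℂ] QEDSmash :=
  smashComul alphaComul eComul eCoaction

/-- The co-unit of `H^α ⋉ H^e`. -/
def qedCounit : QEDSmash →ₐ[ℂ] ℂ := smashCounit alphaCounit eCounit

end QEDHopf

end

/-!
A bialgebra is Hopf as soon as it is conilpotent, that is, every element is killed by a large
convolution power of `Id - η ε`: the convolution inverse of `Id` is then a locally finite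
geometric series. A bialgebra is conilpotent when its generators `g` have co-product
`g ⊗ 1 + ∑ h ⊗ k` with left factors `h` that are already under control. The recursive definitions
of `Δ^α`, `δ^α` and `Δ^p_e` show that a tree `t` has leading term `t ⊗ 1` in all three, the other
left factors having fewer vertices, so `H^α ⋉ H^e` is Hopf. Conilpotency and the bialgebra axioms
pass to sub-objects, hence `ℂ(G^dif) ⋉ H^inv` is Hopf once `Ω ⊗ j` is known to be an embedding.

The series `T(x) = ∑ t_n x^n` satisfies `T = 1 + x T V(T)`. Inserting this in the recursive
definitions gives by induction that `Δ^α t_n` and `δ^α t_n` are the coefficients of `x^n` in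
`∑ t_k x^k ⊗ T(x)^{k+1}` and `∑ t_k x^k ⊗ T(x)^k`, and that the third co-product of `t_n` is
`∑ t_k ⊗ t_{n-k}`: these are the formulae for `a_n` and `b_n`.
-/

noncomputable section

namespace QEDHopf

/-! ### Conilpotent bialgebras -/

section LeftFactors

variable {R M N M' N' A B : Type*} [CommSemiring R] [AddCommMonoid M] [Module R M]
  [AddCommMonoid N] [Module R N] [AddCommMonoid M'] [Module R M'] [AddCommMonoid N'] [Module R N']
  [Semiring A] [Algebra R A] [Semiring B] [Algebra R B]

/-- The tensors with left factors in `P`: the image of `P ⊗ N` in `M ⊗ N`. -/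
def leftFactors (P : Submodule R M) (N : Type*) [AddCommMonoid N] [Module R N] :
    Submodule R (M ⊗[R] N) :=
  Submodule.map₂ (TensorProduct.mk R M N) P ⊤

theorem tmul_mem_leftFactors {P : Submodule R M} {x : M} (hx : x ∈ P) (y : N) :
    x ⊗ₜ[R] y ∈ leftFactors P N :=
  Submodule.apply_mem_map₂ _ hx trivial

theorem leftFactors_le {P : Submodule R M} {Q : Submodule R (M ⊗[R] N)} :
    leftFactors P N ≤ Q ↔ ∀ x ∈ P, ∀ y : N, x ⊗ₜ[R] y ∈ Q := by
  simp [leftFactors, Submodule.map₂_le]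

theorem leftFactors_mono {P Q : Submodule R M} (h : P ≤ Q) : leftFactors P N ≤ leftFactors Q N :=
  Submodule.map₂_le_map₂_left h

theorem map_mem_leftFactors {P : Submodule R M} {Q : Submodule R M'} {f : M →ₗ[R] M'}
    (hf : P ≤ Q.comap f) (g : N →ₗ[R] N') {z : M ⊗[R] N} (hz : z ∈ leftFactors P N) :
    TensorProduct.map f g z ∈ leftFactors Q N' := by
  have h : leftFactors P N ≤ (leftFactors Q N').comap (TensorProduct.map f g) :=
    leftFactors_le.2 fun x hx y => tmul_mem_leftFactors (P := Q) (hf hx) (g y)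
  exact h hz

theorem mul_mem_leftFactors {P Q W : Submodule R A} (h : P * Q ≤ W) {p q : A ⊗[R] B}
    (hp : p ∈ leftFactors P B) (hq : q ∈ leftFactors Q B) : p * q ∈ leftFactors W B := by
  have hmul : leftFactors P B * leftFactors Q B ≤ leftFactors W B := by
    rw [leftFactors, leftFactors, Submodule.map₂_eq_span_image2, Submodule.map₂_eq_span_image2,
      Submodule.span_mul_span, Submodule.span_le]
    rintro _ ⟨_, ⟨x, hx, x', -, rfl⟩, _, ⟨y, hy, y', -, rfl⟩, rfl⟩
    simpa using tmul_mem_leftFactors (h (Submodule.mul_mem_mul hx hy)) (x' * y')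
  exact hmul (Submodule.mul_mem_mul hp hq)

end LeftFactors

section ConvolutionInverse

open Filter WithConv LinearMap

theorem eventually_map_eq {R M N M' N' : Type*} [CommSemiring R] [AddCommMonoid M] [Module R M]
    [AddCommMonoid N] [Module R N] [AddCommMonoid M'] [Module R M'] [AddCommMonoid N']
    [Module R N'] {f : ℕ → M →ₗ[R] M'} {g : ℕ → N →ₗ[R] N'} {f' : M →ₗ[R] M'} {g' : N →ₗ[R] N'}
    (hf : ∀ x, ∀ᶠ n in atTop, f n x = f' x) (hg : ∀ y, ∀ᶠ n in atTop, g n y = g' y)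
    (z : M ⊗[R] N) :
    ∀ᶠ n in atTop, TensorProduct.map (f n) (g n) z = TensorProduct.map f' g' z := by
  induction z with
  | zero => simp
  | add z w hz hw => filter_upwards [hz, hw] with n hz hw using by rw [map_add, map_add, hz, hw]
  | tmul x y =>
    filter_upwards [hf x, hg y] with n hx hy
    rw [TensorProduct.map_tmul, TensorProduct.map_tmul, hx, hy]

theorem exists_eventually_sum_apply_eq {R M N : Type*} [CommRing R] [AddCommGroup M] [Module R M]
    [AddCommGroup N] [Module R N] {f : ℕ → M →ₗ[R] N} (hf : ∀ x, ∀ᶠ k in atTop, f k x = 0) :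
    ∃ S : M →ₗ[R] N, ∀ x, ∀ᶠ n in atTop, (∑ k ∈ Finset.range n, f k) x = S x := by
  have hfin (x : M) : (support fun k => f k x).Finite := by
    obtain ⟨m, hm⟩ := eventually_atTop.1 (hf x)
    exact (Set.finite_lt_nat m).subset fun k hk => not_le.1 fun h => hk (hm k h)
  refine ⟨{ toFun := fun x => ∑ᶠ k, f k x
            map_add' := fun x y => ?_
            map_smul' := fun r x => ?_ }, fun x => ?_⟩
  · simp only [map_add]
    exact finsum_add_distrib (hfin x) (hfin y)
  · simp only [map_smul]
    exact (smul_finsum' r (hfin x)).symm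
  · obtain ⟨m, hm⟩ := eventually_atTop.1 (hf x)
    filter_upwards [eventually_ge_atTop m] with n hn
    rw [LinearMap.sum_apply]
    refine (finsum_eq_sum_of_support_subset _ fun k hk => ?_).symm
    simpa using lt_of_not_ge fun h => hk (hm k (hn.trans h))

variable {R C A : Type*} [CommRing R] [AddCommGroup C] [Module R C] [Coalgebra R C]
  [Ring A] [Algebra R A]

theorem eventually_convMul_eq {f g : ℕ → WithConv (C →ₗ[R] A)} {f' g' : WithConv (C →ₗ[R] A)}
    (hf : ∀ x, ∀ᶠ n in atTop, f n x = f' x) (hg : ∀ x, ∀ᶠ n in atTop, g n x = g' x) (x : C) :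
    ∀ᶠ n in atTop, (f n * g n) x = (f' * g') x := by
  filter_upwards [eventually_map_eq hf hg (Coalgebra.comul x)] with n hn
  exact congrArg (mul' R A) hn

-- The inverse is the geometric series of `u`, a finite sum on each element.
theorem isUnit_one_sub_of_eventually_pow_eq_zero {u : WithConv (C →ₗ[R] A)}
    (hu : ∀ x, ∀ᶠ k in atTop, (u ^ k) x = 0) : IsUnit (1 - u) := by
  obtain ⟨S, hS⟩ := exists_eventually_sum_apply_eq hu
  have hsum (x : C) : ∀ᶠ n in atTop, (∑ k ∈ Finset.range n, u ^ k) x = toConv S x := by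
    filter_upwards [hS x] with n hn
    rw [← ofConv_sum] at hn
    exact hn
  have hone (x : C) : ∀ᶠ n in atTop,
      (1 - u ^ n : WithConv (C →ₗ[R] A)) x = (1 : WithConv (C →ₗ[R] A)) x := by
    filter_upwards [hu x] with n hn
    exact (congrArg (_ - ·) hn).trans (sub_zero _)
  have hconst (x : C) : ∀ᶠ _ in (atTop : Filter ℕ), (1 - u) x = (1 - u) x := .of_forall fun _ => rfl
  have hl : toConv S * (1 - u) = 1 := WithConv.ext <| LinearMap.ext fun x => by
    obtain ⟨n, hn, hn'⟩ := ((eventually_convMul_eq hsum hconst x).and (hone x)).exists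
    exact hn.symm.trans (by rw [geom_sum_mul_neg, hn'])
  have hr : (1 - u) * toConv S = 1 := WithConv.ext <| LinearMap.ext fun x => by
    obtain ⟨n, hn, hn'⟩ := ((eventually_convMul_eq hconst hsum x).and (hone x)).exists
    exact hn.symm.trans (by rw [mul_neg_geom_sum, hn'])
  exact ⟨⟨1 - u, toConv S, hr, hl⟩, rfl⟩

end ConvolutionInverse

section Conilpotent

open Filter WithConv LinearMap

variable (R A : Type*) [CommRing R] [Ring A] [Bialgebra R A]

/-- The opposite `x ↦ ε(x) 1 - x` of the projection onto the augmentation ideal. -/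
def augProj : WithConv (A →ₗ[R] A) := 1 - toConv LinearMap.id

/-- Every element is killed by a large convolution power of the projection onto the augmentation
ideal. -/
def IsConilpotent : Prop := ∀ x : A, ∀ᶠ k in atTop, (augProj R A ^ k) x = 0

variable {R A}

theorem IsConilpotent.isUnit_id (h : IsConilpotent R A) :
    IsUnit (toConv (LinearMap.id : A →ₗ[R] A)) := by
  simpa [augProj] using isUnit_one_sub_of_eventually_pow_eq_zero h

theorem augProj_apply (x : A) :
    (augProj R A).ofConv x = algebraMap R A (Coalgebra.counit x) - x := rfl

theorem map_augProj_pow {B : Type*} [Ring B] [Bialgebra R B] (f : A →ₐc[R] B) (k : ℕ) (x : A) :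
    f ((augProj R A ^ k) x) = (augProj R B ^ k) (f x) := by
  have hone : (f : A →ₐ[R] B).toLinearMap ∘ₗ (1 : WithConv (A →ₗ[R] A)).ofConv =
      (1 : WithConv (B →ₗ[R] B)).ofConv ∘ₗ (f : A →ₗc[R] B).toLinearMap := by
    ext x
    simpa using AlgHomClass.commutes f (Coalgebra.counit x)
  have haug : (f : A →ₐ[R] B).toLinearMap ∘ₗ (augProj R A).ofConv =
      (augProj R B).ofConv ∘ₗ (f : A →ₗc[R] B).toLinearMap := by
    ext x
    simpa [augProj_apply] using AlgHomClass.commutes f (Coalgebra.counit x)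
  have key : (f : A →ₐ[R] B).toLinearMap ∘ₗ (augProj R A ^ k).ofConv =
      (augProj R B ^ k).ofConv ∘ₗ (f : A →ₗc[R] B).toLinearMap := by
    induction k with
    | zero => exact hone
    | succ k ih =>
      rw [pow_succ, pow_succ, algHom_comp_convMul_distrib, convMul_comp_coalgHom_distrib, ih, haug]
  exact congrArg (fun g => g x) key

theorem IsConilpotent.of_injective {B : Type*} [Ring B] [Bialgebra R B] (h : IsConilpotent R B)
    (f : A →ₐc[R] B) (hf : Injective f) : IsConilpotent R A := fun x => by
  filter_upwards [h (f x)] with k hk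
  exact hf (by rw [map_augProj_pow, hk, map_zero])

variable (R A) in
/-- The increasing filtration that starts with the scalars and whose next step consists of the `x`
such that `Δ x - x ⊗ 1` has its left factors in the previous step. -/
def conilFiltration : ℕ → Submodule R A
  | 0 => 1
  | n + 1 => (leftFactors (conilFiltration n) A).comap
      (Coalgebra.comul - (TensorProduct.mk R A A).flip 1)

theorem mem_conilFiltration_succ {n : ℕ} {x : A} : x ∈ conilFiltration R A (n + 1) ↔
    Coalgebra.comul x - x ⊗ₜ[R] 1 ∈ leftFactors (conilFiltration R A n) A := Iff.rfl

theorem conilFiltration_mono : Monotone (conilFiltration R A) := by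
  refine monotone_nat_of_le_succ fun n => ?_
  induction n with
  | zero =>
    rintro _ ⟨r, rfl⟩
    simp [mem_conilFiltration_succ, Algebra.TensorProduct.one_def, TensorProduct.smul_tmul']
  | succ n ih => exact fun x hx => leftFactors_mono ih hx

theorem mul_conilFiltration_le (m n : ℕ) :
    conilFiltration R A m * conilFiltration R A n ≤ conilFiltration R A (m + n) := by
  induction hk : m + n using Nat.strong_induction_on generalizing m n with | _ k ih
  subst hk
  rcases m with _ | m
  · exact (one_mul _).le.trans (by rw [zero_add])
  rcases n with _ | n
  · exact (mul_one _).le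
  refine Submodule.mul_le.2 fun x hx y hy => ?_
  have hcomul : Coalgebra.comul (x * y) - (x * y) ⊗ₜ[R] 1 =
      x ⊗ₜ 1 * (Coalgebra.comul y - y ⊗ₜ 1) + (Coalgebra.comul x - x ⊗ₜ 1) * y ⊗ₜ 1 +
        (Coalgebra.comul x - x ⊗ₜ 1) * (Coalgebra.comul y - y ⊗ₜ 1) := by
    rw [Bialgebra.comul_mul, ← mul_one (1 : A), ← Algebra.TensorProduct.tmul_mul_tmul, mul_one]
    noncomm_ring
  have h₁ := ih (m + 1 + n) (by omega) (m + 1) n rfl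
  have h₂ := ih (m + 1 + n) (by omega) m (n + 1) (by omega)
  have h₃ := (ih (m + n) (by omega) m n rfl).trans
    (conilFiltration_mono (by omega : m + n ≤ m + 1 + n))
  rw [← add_assoc (m + 1) n 1, mem_conilFiltration_succ, hcomul]
  exact add_mem (add_mem (mul_mem_leftFactors h₁ (tmul_mem_leftFactors hx 1) hy)
    (mul_mem_leftFactors h₂ hx (tmul_mem_leftFactors hy 1))) (mul_mem_leftFactors h₃ hx hy)

variable (R A) in
/-- The union of the filtration `conilFiltration`. -/
def conilSubalgebra : Subalgebra R A :=
  (⨆ n, conilFiltration R A n).toSubalgebra (Submodule.mem_iSup_of_mem 0 ⟨1, by simp⟩)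
    fun x y hx hy => by
      rw [Submodule.mem_iSup_of_directed _ conilFiltration_mono.directed_le] at hx hy
      obtain ⟨m, hx⟩ := hx
      obtain ⟨n, hy⟩ := hy
      exact Submodule.mem_iSup_of_mem (m + n)
        (mul_conilFiltration_le m n (Submodule.mul_mem_mul hx hy))

theorem mem_conilSubalgebra {x : A} :
    x ∈ conilSubalgebra R A ↔ ∃ n, x ∈ conilFiltration R A n :=
  Submodule.mem_iSup_of_directed _ conilFiltration_mono.directed_le

theorem mem_conilSubalgebra_of_comul {x : A} (h : Coalgebra.comul x - x ⊗ₜ[R] 1 ∈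
    leftFactors (conilSubalgebra R A).toSubmodule A) : x ∈ conilSubalgebra R A := by
  have hsup : leftFactors (conilSubalgebra R A).toSubmodule A =
      ⨆ n, leftFactors (conilFiltration R A n) A :=
    Submodule.map₂_iSup_left _ (conilFiltration R A) ⊤
  rw [hsup, Submodule.mem_iSup_of_directed _
    (Monotone.directed_le fun _ _ h => leftFactors_mono (conilFiltration_mono h))] at h
  obtain ⟨n, hn⟩ := h
  exact mem_conilSubalgebra.2 ⟨n + 1, hn⟩

theorem augProj_pow_eq_zero {n k : ℕ} (hk : n < k) {x : A} (hx : x ∈ conilFiltration R A n) :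
    (augProj R A ^ k).ofConv x = 0 := by
  induction k generalizing n x with
  | zero => omega
  | succ k ih =>
    have hone (y : A) : (mul' R A) (TensorProduct.map (augProj R A ^ k).ofConv
        (augProj R A).ofConv (y ⊗ₜ 1)) = 0 := by simp [augProj_apply]
    change mul' R A (TensorProduct.map (augProj R A ^ k).ofConv (augProj R A).ofConv
      (Coalgebra.comul x)) = 0
    rcases n with _ | n
    · obtain ⟨r, rfl⟩ := hx
      simpa [Algebra.TensorProduct.one_def] using congrArg (r • ·) (hone 1)
    · have hle : leftFactors (conilFiltration R A n) A ≤ LinearMap.ker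
          (mul' R A ∘ₗ TensorProduct.map (augProj R A ^ k).ofConv (augProj R A).ofConv) :=
        leftFactors_le.2 fun y hy z => by simp [ih (Nat.lt_of_succ_lt_succ hk) hy]
      have hx' := hle hx
      rw [← sub_add_cancel (Coalgebra.comul x) (x ⊗ₜ[R] (1 : A)), map_add, map_add, hone, add_zero]
      exact hx'

theorem isConilpotent_of_conilSubalgebra_eq_top (h : conilSubalgebra R A = ⊤) :
    IsConilpotent R A := fun x => by
  obtain ⟨n, hn⟩ := mem_conilSubalgebra.1 (h ▸ trivial : x ∈ conilSubalgebra R A)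
  filter_upwards [eventually_gt_atTop n] with k hk using augProj_pow_eq_zero hk hn

end Conilpotent

/-! ### Bialgebras presented by algebra homomorphisms -/

section Bialgebra

open WithConv

/-- `Δ` and `ε` make the algebra `A` a bialgebra. -/
structure IsBialgebra {R A : Type*} [CommSemiring R] [Semiring A] [Algebra R A]
    (Δ : A →ₐ[R] A ⊗[R] A) (ε : A →ₐ[R] R) : Prop where
  coassoc : (Algebra.TensorProduct.assoc R R R A A A).toAlgHom.comp
      ((Algebra.TensorProduct.map Δ (AlgHom.id R A)).comp Δ) =
    (Algebra.TensorProduct.map (AlgHom.id R A) Δ).comp Δ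
  rTensor : (Algebra.TensorProduct.map ε (AlgHom.id R A)).comp Δ =
    (Algebra.TensorProduct.lid R A).symm
  lTensor : (Algebra.TensorProduct.map (AlgHom.id R A) ε).comp Δ =
    (Algebra.TensorProduct.rid R R A).symm

/-- The bialgebra with underlying algebra `A`, co-product `Δ` and co-unit `ε`. -/
@[reducible] def IsBialgebra.bialgebra {R A : Type*} [CommSemiring R] [Semiring A] [Algebra R A]
    {Δ : A →ₐ[R] A ⊗[R] A} {ε : A →ₐ[R] R} (h : IsBialgebra Δ ε) : Bialgebra R A :=
  Bialgebra.ofAlgHom Δ ε h.coassoc h.rTensor h.lTensor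

theorem IsBialgebra.isHopf {A : Type} [Ring A] [Algebra ℂ A] {Δ : A →ₐ[ℂ] A ⊗[ℂ] A}
    {ε : A →ₐ[ℂ] ℂ} (h : IsBialgebra Δ ε)
    (hconil : letI := h.bialgebra; IsConilpotent ℂ A) : IsHopf Δ ε := by
  let := h.bialgebra
  obtain ⟨u, hu⟩ := hconil.isUnit_id
  refine ⟨h.coassoc, h.rTensor, h.lTensor, (↑u⁻¹ : WithConv (A →ₗ[ℂ] A)).ofConv, ?_, ?_⟩
  · exact congrArg ofConv (hu ▸ u.inv_mul : (↑u⁻¹ : WithConv (A →ₗ[ℂ] A)) * toConv .id = 1)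
  · exact congrArg ofConv (hu ▸ u.mul_inv : toConv .id * (↑u⁻¹ : WithConv (A →ₗ[ℂ] A)) = 1)

section Intertwining

open Algebra.TensorProduct

variable {R A B : Type*} [CommSemiring R] [Semiring A] [Algebra R A] [Semiring B] [Algebra R B]
  {ΔA : A →ₐ[R] A ⊗[R] A} {εA : A →ₐ[R] R} {ΔB : B →ₐ[R] B ⊗[R] B} {εB : B →ₐ[R] R}
  {f : A →ₐ[R] B}

theorem map_comul_id_comp_comul_comp (hΔ : ΔB.comp f = (map f f).comp ΔA) :
    ((map ΔB (.id R B)).comp ΔB).comp f =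
      (map (map f f) f).comp ((map ΔA (.id R A)).comp ΔA) := by
  rw [AlgHom.comp_assoc, hΔ, ← AlgHom.comp_assoc, ← AlgHom.comp_assoc, ← map_comp, ← map_comp, hΔ,
    AlgHom.comp_id, AlgHom.id_comp]

theorem map_id_comul_comp_comul_comp (hΔ : ΔB.comp f = (map f f).comp ΔA) :
    ((map (.id R B) ΔB).comp ΔB).comp f =
      (map f (map f f)).comp ((map (.id R A) ΔA).comp ΔA) := by
  rw [AlgHom.comp_assoc, hΔ, ← AlgHom.comp_assoc, ← AlgHom.comp_assoc, ← map_comp, ← map_comp, hΔ,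
    AlgHom.comp_id, AlgHom.id_comp]

theorem map_counit_id_comp_comul_comp (hΔ : ΔB.comp f = (map f f).comp ΔA)
    (hε : εB.comp f = εA) : ((map εB (.id R B)).comp ΔB).comp f =
      (map (.id R R) f).comp ((map εA (.id R A)).comp ΔA) := by
  rw [AlgHom.comp_assoc, hΔ, ← AlgHom.comp_assoc, ← AlgHom.comp_assoc, ← map_comp, ← map_comp, hε,
    AlgHom.comp_id, AlgHom.id_comp, AlgHom.id_comp]

theorem map_id_counit_comp_comul_comp (hΔ : ΔB.comp f = (map f f).comp ΔA)
    (hε : εB.comp f = εA) : ((map (.id R B) εB).comp ΔB).comp f =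
      (map f (.id R R)).comp ((map (.id R A) εA).comp ΔA) := by
  rw [AlgHom.comp_assoc, hΔ, ← AlgHom.comp_assoc, ← AlgHom.comp_assoc, ← map_comp, ← map_comp, hε,
    AlgHom.comp_id, AlgHom.id_comp, AlgHom.id_comp]

theorem assoc_comp_map (f : A →ₐ[R] B) :
    (Algebra.TensorProduct.assoc R R R B B B).toAlgHom.comp (map (map f f) f) =
      (map f (map f f)).comp (Algebra.TensorProduct.assoc R R R A A A).toAlgHom := by
  ext <;> rfl

theorem comul_coassoc_comp_iff (hΔ : ΔB.comp f = (map f f).comp ΔA) :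
    ((Algebra.TensorProduct.assoc R R R B B B).toAlgHom.comp
        ((map ΔB (.id R B)).comp ΔB)).comp f = ((map (.id R B) ΔB).comp ΔB).comp f ↔
      (map f (map f f)).comp ((Algebra.TensorProduct.assoc R R R A A A).toAlgHom.comp
        ((map ΔA (.id R A)).comp ΔA)) =
      (map f (map f f)).comp ((map (.id R A) ΔA).comp ΔA) := by
  rw [AlgHom.comp_assoc, map_comul_id_comp_comul_comp hΔ, map_id_comul_comp_comul_comp hΔ,
    ← AlgHom.comp_assoc, assoc_comp_map, AlgHom.comp_assoc]

end Intertwining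

open Algebra.TensorProduct in
theorem IsBialgebra.of_injective {K A B : Type*} [Field K] [Ring A] [Algebra K A]
    [Ring B] [Algebra K B] {ΔA : A →ₐ[K] A ⊗[K] A} {εA : A →ₐ[K] K}
    {ΔB : B →ₐ[K] B ⊗[K] B} {εB : B →ₐ[K] K}
    (h : IsBialgebra ΔB εB) (f : A →ₐ[K] B) (hf : Injective f)
    (hΔ : ΔB.comp f = (map f f).comp ΔA) (hε : εB.comp f = εA) :
    IsBialgebra ΔA εA := by
  have hff : Injective (map f f) :=
    TensorProduct.map_injective_of_flat_flat f.toLinearMap f.toLinearMap hf hf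
  have hfff : Injective (map f (map f f)) :=
    TensorProduct.map_injective_of_flat_flat f.toLinearMap (map f f).toLinearMap hf hff
  have hidf : Injective (map (.id K K) f) :=
    Module.Flat.lTensor_preserves_injective_linearMap f.toLinearMap hf
  have hfid : Injective (map f (.id K K)) :=
    Module.Flat.rTensor_preserves_injective_linearMap f.toLinearMap hf
  refine ⟨?_, ?_, ?_⟩
  · rw [← AlgHom.cancel_left hfff, ← comul_coassoc_comp_iff hΔ, h.coassoc]
  · rw [← AlgHom.cancel_left hidf, ← map_counit_id_comp_comul_comp hΔ hε, h.rTensor]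
    rfl
  · rw [← AlgHom.cancel_left hfid, ← map_id_counit_comp_comul_comp hΔ hε, h.lTensor]
    rfl

theorem map_antipode {R A B : Type*} [CommSemiring R] [Semiring A] [Semiring B] [HopfAlgebra R A]
    [HopfAlgebra R B] (f : A →ₐc[R] B) (x : A) :
    f (HopfAlgebra.antipode R x) = HopfAlgebra.antipode R (f x) := by
  have hunit : (f : A →ₐ[R] B).toLinearMap ∘ₗ (1 : WithConv (A →ₗ[R] A)).ofConv =
      (1 : WithConv (A →ₗ[R] B)).ofConv := by
    ext y
    exact (f : A →ₐ[R] B).commutes _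
  have hcounit : (1 : WithConv (B →ₗ[R] B)).ofConv ∘ₗ (f : A →ₗc[R] B).toLinearMap =
      (1 : WithConv (A →ₗ[R] B)).ofConv := by
    ext y
    exact congrArg (algebraMap R B) (CoalgHomClass.counit_comp_apply f y)
  have hl : toConv ((f : A →ₐ[R] B).toLinearMap ∘ₗ HopfAlgebra.antipode R) *
      toConv (f : A →ₐ[R] B).toLinearMap = 1 := by
    have h := LinearMap.algHom_comp_convMul_distrib (f : A →ₐ[R] B)
      (toConv (HopfAlgebra.antipode R (A := A))) (toConv LinearMap.id)
    rw [LinearMap.antipode_mul_id, hunit] at h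
    exact (WithConv.ext h).symm
  have hr : toConv (f : A →ₐ[R] B).toLinearMap *
      toConv (HopfAlgebra.antipode R ∘ₗ (f : A →ₗc[R] B).toLinearMap) = 1 := by
    have h := LinearMap.convMul_comp_coalgHom_distrib (toConv LinearMap.id)
      (toConv (HopfAlgebra.antipode R (A := B))) (f : A →ₗc[R] B)
    rw [LinearMap.id_mul_antipode, hcounit] at h
    exact (WithConv.ext h).symm
  exact congrArg (fun g => g.ofConv x) (left_inv_eq_right_inv hl hr)

end Bialgebra

/-! ### Semi-direct co-products -/

section Smash

open Algebra.TensorProduct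

variable {H B : Type} [CommRing H] [Algebra ℂ H] [Ring B] [Algebra ℂ B]

variable (H B) in
/-- `(c ⊗ h) ⊗ (d ⊗ k) ↦ (c ⊗ d) ⊗ h k`, which combines the co-actions on the two factors of
`B ⊗ B`. -/
def coactionMul : (B ⊗[ℂ] H) ⊗[ℂ] (B ⊗[ℂ] H) →ₐ[ℂ] (B ⊗[ℂ] B) ⊗[ℂ] H :=
  (map (AlgHom.id ℂ (B ⊗[ℂ] B)) (lmul' ℂ)).comp
    (tensorTensorTensorComm ℂ ℂ ℂ ℂ B H B H).toAlgHom

/-- `δ` is a right co-action of the bialgebra `H` on the bialgebra `B` for which the co-product and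
the co-unit of `B` are homomorphisms of comodules. -/
structure IsComoduleBialgebra (ΔH : H →ₐ[ℂ] H ⊗[ℂ] H) (εH : H →ₐ[ℂ] ℂ) (ΔB : B →ₐ[ℂ] B ⊗[ℂ] B)
    (εB : B →ₐ[ℂ] ℂ) (δ : B →ₐ[ℂ] B ⊗[ℂ] H) : Prop where
  coassoc : (Algebra.TensorProduct.assoc ℂ ℂ ℂ B H H).toAlgHom.comp
    ((map δ (.id ℂ H)).comp δ) = (map (.id ℂ B) ΔH).comp δ
  lTensor : (map (.id ℂ B) εH).comp δ = (Algebra.TensorProduct.rid ℂ ℂ B).symm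
  comul : (map ΔB (.id ℂ H)).comp δ = (coactionMul H B).comp ((map δ δ).comp ΔB)
  counit : (map εB (.id ℂ H)).comp δ = includeLeft.comp εB

section Abstract

-- An algebra `T` with maps from `H` and `B` stands for `H ⊗ B`, and `D` for its co-product.
variable {T : Type} [Ring T] [Algebra ℂ T] {ΔH : H →ₐ[ℂ] H ⊗[ℂ] H} {εH : H →ₐ[ℂ] ℂ}
  {ΔB : B →ₐ[ℂ] B ⊗[ℂ] B} {εB : B →ₐ[ℂ] ℂ} {δ : B →ₐ[ℂ] B ⊗[ℂ] H} {ιH : H →ₐ[ℂ] T}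
  {ιB : B →ₐ[ℂ] T} {D : T →ₐ[ℂ] T ⊗[ℂ] T} {ε : T →ₐ[ℂ] ℂ}

/-- `x ⊗ y ↦ (ιB ⊗ ιH) (δ x) * (1 ⊗ ιB y)`, which turns `ΔB b` into the semi-direct co-product
of `b`. -/
def smashTwist (δ : B →ₐ[ℂ] B ⊗[ℂ] H) (ιH : H →ₐ[ℂ] T) (ιB : B →ₐ[ℂ] T) :
    B ⊗[ℂ] B →ₗ[ℂ] T ⊗[ℂ] T :=
  LinearMap.mul' ℂ (T ⊗[ℂ] T) ∘ₗ TensorProduct.map ((map ιB ιH).comp δ).toLinearMap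
    ((includeRight : T →ₐ[ℂ] T ⊗[ℂ] T).comp ιB).toLinearMap

theorem smashTwist_tmul (x y : B) :
    smashTwist δ ιH ιB (x ⊗ₜ y) = map ιB ιH (δ x) * 1 ⊗ₜ ιB y := rfl

/-- `x ⊗ w ↦ (ιB ⊗ ιH ⊗ ιH) ((Id ⊗ ΔH) (δ x)) * (1 ⊗ smashTwist w)`, which turns the iterated
co-product of `b` in `B` into that in the semi-direct co-product. -/
def smashTwist₃ (ΔH : H →ₐ[ℂ] H ⊗[ℂ] H) (δ : B →ₐ[ℂ] B ⊗[ℂ] H) (ιH : H →ₐ[ℂ] T)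
    (ιB : B →ₐ[ℂ] T) : B ⊗[ℂ] (B ⊗[ℂ] B) →ₗ[ℂ] T ⊗[ℂ] (T ⊗[ℂ] T) :=
  LinearMap.mul' ℂ _ ∘ₗ TensorProduct.map
    ((map ιB (map ιH ιH)).comp ((map (.id ℂ B) ΔH).comp δ)).toLinearMap
    ((includeRight : _ →ₐ[ℂ] T ⊗[ℂ] (T ⊗[ℂ] T)).toLinearMap ∘ₗ smashTwist δ ιH ιB)

theorem smashTwist₃_tmul (x : B) (w : B ⊗[ℂ] B) :
    smashTwist₃ ΔH δ ιH ιB (x ⊗ₜ w) =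
      map ιB (map ιH ιH) (map (.id ℂ B) ΔH (δ x)) * 1 ⊗ₜ smashTwist δ ιH ιB w := rfl

theorem map_id_smashTwist (hH : D.comp ιH = (map ιH ιH).comp ΔH)
    (hB : ∀ b, D (ιB b) = smashTwist δ ιH ιB (ΔB b)) (z : B ⊗[ℂ] B) :
    map (.id ℂ T) D (smashTwist δ ιH ιB z) = smashTwist₃ ΔH δ ιH ιB (map (.id ℂ B) ΔB z) := by
  have hδ : (map (.id ℂ T) D).comp (map ιB ιH) =
      (map ιB (map ιH ιH)).comp (map (.id ℂ B) ΔH) := by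
    rw [← map_comp, ← map_comp, hH, AlgHom.id_comp, AlgHom.comp_id]
  refine DFunLike.congr_fun (f := (map (.id ℂ T) D).toLinearMap ∘ₗ smashTwist δ ιH ιB)
    (g := smashTwist₃ ΔH δ ιH ιB ∘ₗ (map (.id ℂ B) ΔB).toLinearMap)
    (TensorProduct.ext' fun x y => ?_) z
  have hδx := DFunLike.congr_fun hδ (δ x)
  simp only [AlgHom.comp_apply] at hδx
  simp only [LinearMap.comp_apply, AlgHom.toLinearMap_apply, smashTwist_tmul, map_tmul,
    AlgHom.id_apply, smashTwist₃_tmul, map_mul, map_one, hδx, hB]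

theorem assoc_map_smashTwist_coactionMul (p q : B ⊗[ℂ] H) :
    Algebra.TensorProduct.assoc ℂ ℂ ℂ T T T
        (TensorProduct.map (smashTwist δ ιH ιB) ιH.toLinearMap (coactionMul H B (p ⊗ₜ q))) =
      map ιB (map ιH ιH) (Algebra.TensorProduct.assoc ℂ ℂ ℂ B H H (map δ (.id ℂ H) p)) *
        1 ⊗ₜ map ιB ιH q := by
  have hassoc (w : B ⊗[ℂ] H) (h : H) : map ιB (map ιH ιH)
      (Algebra.TensorProduct.assoc ℂ ℂ ℂ B H H (w ⊗ₜ h)) =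
        Algebra.TensorProduct.assoc ℂ ℂ ℂ T T T (map ιB ιH w ⊗ₜ ιH h) := by
    induction w with
    | zero => simp only [TensorProduct.zero_tmul, map_zero]
    | tmul c k => rfl
    | add w w' hw hw' => simp only [TensorProduct.add_tmul, map_add, hw, hw']
  induction p with
  | zero => simp only [TensorProduct.zero_tmul, map_zero, zero_mul]
  | add p p' hp hp' => simp only [TensorProduct.add_tmul, map_add, hp, hp', add_mul]
  | tmul c h =>
    induction q with
    | zero => simp only [TensorProduct.tmul_zero, map_zero, mul_zero]
    | add q q' hq hq' => simp only [TensorProduct.tmul_add, map_add, hq, hq', mul_add]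
    | tmul d k =>
      calc _ = Algebra.TensorProduct.assoc ℂ ℂ ℂ T T T
            ((map ιB ιH (δ c) * 1 ⊗ₜ ιB d) ⊗ₜ ιH (h * k)) := rfl
        _ = Algebra.TensorProduct.assoc ℂ ℂ ℂ T T T (map ιB ιH (δ c) ⊗ₜ ιH h) *
            1 ⊗ₜ (ιB d ⊗ₜ ιH k) := by
          rw [map_mul ιH, ← tmul_mul_tmul, map_mul]; rfl
        _ = _ := by rw [← hassoc]; rfl

theorem assoc_map_smashTwist_mul (hδ : IsComoduleBialgebra ΔH εH ΔB εB δ) (w : B ⊗[ℂ] B) (y : B) :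
    Algebra.TensorProduct.assoc ℂ ℂ ℂ T T T (TensorProduct.map (smashTwist δ ιH ιB) ιH.toLinearMap
        (coactionMul H B (map δ δ w))) * 1 ⊗ₜ (1 ⊗ₜ ιB y) =
      smashTwist₃ ΔH δ ιH ιB (Algebra.TensorProduct.assoc ℂ ℂ ℂ B B B (w ⊗ₜ y)) := by
  induction w with
  | zero => simp only [TensorProduct.zero_tmul, map_zero, zero_mul]
  | add w w' hw hw' => simp only [TensorProduct.add_tmul, map_add, add_mul, hw, hw']
  | tmul u v =>
    have hcoassoc : Algebra.TensorProduct.assoc ℂ ℂ ℂ B H H (map δ (.id ℂ H) (δ u)) =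
        map (.id ℂ B) ΔH (δ u) := DFunLike.congr_fun hδ.coassoc u
    rw [map_tmul, assoc_map_smashTwist_coactionMul, hcoassoc, mul_assoc, tmul_mul_tmul, one_mul,
      assoc_tmul, smashTwist₃_tmul, smashTwist_tmul]

theorem assoc_map_comul_smashTwist (hδ : IsComoduleBialgebra ΔH εH ΔB εB δ)
    (hB : ∀ b, D (ιB b) = smashTwist δ ιH ιB (ΔB b)) (z : B ⊗[ℂ] B) :
    Algebra.TensorProduct.assoc ℂ ℂ ℂ T T T (map D (.id ℂ T) (smashTwist δ ιH ιB z)) =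
      smashTwist₃ ΔH δ ιH ιB (Algebra.TensorProduct.assoc ℂ ℂ ℂ B B B (map ΔB (.id ℂ B) z)) := by
  have hD (p : B ⊗[ℂ] H) : map D (.id ℂ T) (map ιB ιH p) =
      TensorProduct.map (smashTwist δ ιH ιB) ιH.toLinearMap (map ΔB (.id ℂ H) p) := by
    induction p with
    | zero => simp only [map_zero]
    | add p q hp hq => simp only [map_add, hp, hq]
    | tmul c h => simp only [map_tmul, hB, TensorProduct.map_tmul, AlgHom.id_apply,
        AlgHom.toLinearMap_apply]
  induction z with
  | zero => simp only [map_zero]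
  | add z w hz hw => simp only [map_add, hz, hw]
  | tmul x y =>
    have hcomul : map ΔB (.id ℂ H) (δ x) = coactionMul H B (map δ δ (ΔB x)) :=
      DFunLike.congr_fun hδ.comul x
    rw [smashTwist_tmul, map_mul, map_mul, hD, hcomul, map_tmul, map_one, AlgHom.id_apply,
      one_def, assoc_tmul, assoc_map_smashTwist_mul hδ, map_tmul, AlgHom.id_apply]

theorem map_counit_id_smashTwist (hδ : IsComoduleBialgebra ΔH εH ΔB εB δ)
    (hε : ε.comp ιB = εB) (z : B ⊗[ℂ] B) :
    map ε (.id ℂ T) (smashTwist δ ιH ιB z) = map (.id ℂ ℂ) ιB (map εB (.id ℂ B) z) := by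
  have hmap : (map ε (.id ℂ T)).comp (map ιB ιH) = (map (.id ℂ ℂ) ιH).comp (map εB (.id ℂ H)) := by
    rw [← map_comp, ← map_comp, hε, AlgHom.id_comp, AlgHom.id_comp, AlgHom.comp_id]
  induction z with
  | zero => simp only [map_zero]
  | add z w hz hw => simp only [map_add, hz, hw]
  | tmul x y =>
    have hcounit : map εB (.id ℂ H) (δ x) = εB x ⊗ₜ 1 := DFunLike.congr_fun hδ.counit x
    rw [smashTwist_tmul, map_mul, ← AlgHom.comp_apply (map ε _), hmap, AlgHom.comp_apply, hcounit]
    simp only [map_tmul, map_one, AlgHom.id_apply, tmul_mul_tmul, mul_one, one_mul]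

theorem map_id_counit_smashTwist (hδ : IsComoduleBialgebra ΔH εH ΔB εB δ)
    (hεH : ε.comp ιH = εH) (hεB : ε.comp ιB = εB) (z : B ⊗[ℂ] B) :
    map (.id ℂ T) ε (smashTwist δ ιH ιB z) = map ιB (.id ℂ ℂ) (map (.id ℂ B) εB z) := by
  have hmap : (map (.id ℂ T) ε).comp (map ιB ιH) = (map ιB (.id ℂ ℂ)).comp (map (.id ℂ B) εH) := by
    rw [← map_comp, ← map_comp, hεH, AlgHom.id_comp, AlgHom.id_comp, AlgHom.comp_id]
  induction z with
  | zero => simp only [map_zero]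
  | add z w hz hw => simp only [map_add, hz, hw]
  | tmul x y =>
    have hcounit : map (.id ℂ B) εH (δ x) = x ⊗ₜ 1 := DFunLike.congr_fun hδ.lTensor x
    rw [smashTwist_tmul, map_mul, ← AlgHom.comp_apply (map _ ε), hmap, AlgHom.comp_apply, hcounit]
    simp only [map_tmul, map_one, AlgHom.id_apply, tmul_mul_tmul, mul_one, one_mul,
      ← AlgHom.comp_apply ε, hεB]

end Abstract

theorem smashComul_comp_includeLeft (ΔH : H →ₐ[ℂ] H ⊗[ℂ] H) (ΔB : B →ₐ[ℂ] B ⊗[ℂ] B)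
    (δ : B →ₐ[ℂ] B ⊗[ℂ] H) :
    (smashComul ΔH ΔB δ).comp includeLeft = (map includeLeft includeLeft).comp ΔH :=
  lift_comp_includeLeft _ _ (smash_commute ΔH ΔB δ)

theorem smashComul_includeRight (ΔH : H →ₐ[ℂ] H ⊗[ℂ] H) (ΔB : B →ₐ[ℂ] B ⊗[ℂ] B)
    (δ : B →ₐ[ℂ] B ⊗[ℂ] H) (b : B) :
    smashComul ΔH ΔB δ (includeRight b) = smashTwist δ includeLeft includeRight (ΔB b) := by
  have hassoc (w : B ⊗[ℂ] H) (y : B) : map (includeRight : B →ₐ[ℂ] H ⊗[ℂ] B) (.id ℂ (H ⊗[ℂ] B))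
      (Algebra.TensorProduct.assoc ℂ ℂ ℂ B H B (w ⊗ₜ y)) =
        map includeRight includeLeft w * 1 ⊗ₜ includeRight y := by
    induction w with
    | zero => simp only [TensorProduct.zero_tmul, map_zero, zero_mul]
    | add w w' hw hw' => simp only [TensorProduct.add_tmul, map_add, hw, hw', add_mul]
    | tmul x h => simp
  have hright (z : B ⊗[ℂ] B) : map (includeRight : B →ₐ[ℂ] H ⊗[ℂ] B) (.id ℂ (H ⊗[ℂ] B))
      (Algebra.TensorProduct.assoc ℂ ℂ ℂ B H B (map δ (.id ℂ B) z)) =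
        smashTwist δ includeLeft includeRight z := by
    induction z with
    | zero => simp only [map_zero]
    | add z w hz hw => simp only [map_add, hz, hw]
    | tmul x y => rw [map_tmul, AlgHom.id_apply, hassoc, smashTwist_tmul]
  exact (DFunLike.congr_fun (lift_comp_includeRight _ _ (smash_commute ΔH ΔB δ)) b).trans
    (hright (ΔB b))

theorem IsBialgebra.smash {ΔH : H →ₐ[ℂ] H ⊗[ℂ] H} {εH : H →ₐ[ℂ] ℂ} {ΔB : B →ₐ[ℂ] B ⊗[ℂ] B}
    {εB : B →ₐ[ℂ] ℂ} {δ : B →ₐ[ℂ] B ⊗[ℂ] H} (hH : IsBialgebra ΔH εH) (hB : IsBialgebra ΔB εB)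
    (hδ : IsComoduleBialgebra ΔH εH ΔB εB δ) :
    IsBialgebra (smashComul ΔH ΔB δ) (smashCounit εH εB) := by
  have hD := smashComul_comp_includeLeft ΔH ΔB δ
  have hD' := smashComul_includeRight ΔH ΔB δ
  have hε : (smashCounit εH εB).comp includeLeft = εH :=
    lift_comp_includeLeft _ _ fun _ _ => .all _ _
  have hε' : (smashCounit εH εB).comp includeRight = εB :=
    lift_comp_includeRight _ _ fun _ _ => .all _ _
  refine ⟨?_, ?_, ?_⟩ <;> refine Algebra.TensorProduct.ext ?_ (AlgHom.ext fun b => ?_)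
  · exact (comul_coassoc_comp_iff hD).2 (congrArg _ hH.coassoc)
  · have hcoassoc : Algebra.TensorProduct.assoc ℂ ℂ ℂ B B B (map ΔB (.id ℂ B) (ΔB b)) =
      map (.id ℂ B) ΔB (ΔB b) := DFunLike.congr_fun hB.coassoc b
    calc _ = Algebra.TensorProduct.assoc ℂ ℂ ℂ _ _ _ (map (smashComul ΔH ΔB δ) (.id ℂ _)
          (smashTwist δ includeLeft includeRight (ΔB b))) := by rw [← hD']; rfl
      _ = map (.id ℂ _) (smashComul ΔH ΔB δ) (smashTwist δ includeLeft includeRight (ΔB b)) := by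
        rw [assoc_map_comul_smashTwist hδ hD', hcoassoc, map_id_smashTwist hD hD']
      _ = _ := by rw [← hD']; rfl
  · exact (map_counit_id_comp_comul_comp hD hε).trans (congrArg _ hH.rTensor)
  · calc _ = map (smashCounit εH εB) (.id ℂ _) (smashTwist δ includeLeft includeRight (ΔB b)) := by
          rw [← hD']; rfl
      _ = map (.id ℂ ℂ) includeRight (map εB (.id ℂ B) (ΔB b)) :=
        map_counit_id_smashTwist hδ hε' _
      _ = _ := congrArg _ (DFunLike.congr_fun hB.rTensor b)
  · exact (map_id_counit_comp_comul_comp hD hε).trans (congrArg _ hH.lTensor)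
  · calc _ = map (.id ℂ _) (smashCounit εH εB) (smashTwist δ includeLeft includeRight (ΔB b)) := by
          rw [← hD']; rfl
      _ = map includeRight (.id ℂ ℂ) (map (.id ℂ B) εB (ΔB b)) :=
        map_id_counit_smashTwist hδ hε hε' _
      _ = _ := congrArg _ (DFunLike.congr_fun hB.lTensor b)

theorem smashComul_includeLeft_sub_mem {ΔH : H →ₐ[ℂ] H ⊗[ℂ] H} {ΔB : B →ₐ[ℂ] B ⊗[ℂ] B}
    {δ : B →ₐ[ℂ] B ⊗[ℂ] H} {P : Submodule ℂ H} {Q : Submodule ℂ (H ⊗[ℂ] B)}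
    (hP : P ≤ Q.comap (includeLeft : H →ₐ[ℂ] H ⊗[ℂ] B).toLinearMap) {x : H}
    (hx : ΔH x - x ⊗ₜ[ℂ] 1 ∈ leftFactors P H) :
    smashComul ΔH ΔB δ (x ⊗ₜ 1) - (x ⊗ₜ 1) ⊗ₜ 1 ∈ leftFactors Q (H ⊗[ℂ] B) := by
  let ιH : H →ₐ[ℂ] H ⊗[ℂ] B := includeLeft
  have hD : smashComul ΔH ΔB δ (x ⊗ₜ 1) = map ιH ιH (ΔH x) :=
    DFunLike.congr_fun (smashComul_comp_includeLeft ΔH ΔB δ) x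
  have hsub : smashComul ΔH ΔB δ (x ⊗ₜ 1) - (x ⊗ₜ 1) ⊗ₜ 1 =
      map ιH ιH (ΔH x - x ⊗ₜ[ℂ] 1) := by
    rw [hD, map_sub, map_tmul, map_one]; rfl
  rw [hsub]
  exact map_mem_leftFactors hP ιH.toLinearMap hx

theorem smashComul_includeRight_sub_mem {ΔH : H →ₐ[ℂ] H ⊗[ℂ] H} {ΔB : B →ₐ[ℂ] B ⊗[ℂ] B}
    {δ : B →ₐ[ℂ] B ⊗[ℂ] H} {P : Submodule ℂ B} {Q : Submodule ℂ (H ⊗[ℂ] B)}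
    (hP : P ≤ Q.comap (includeRight : B →ₐ[ℂ] H ⊗[ℂ] B).toLinearMap)
    (hδP : P ≤ (leftFactors P H).comap δ.toLinearMap) {x : B}
    (hΔ : ΔB x - x ⊗ₜ 1 ∈ leftFactors P B) (hδ : δ x - x ⊗ₜ 1 ∈ leftFactors P H) :
    smashComul ΔH ΔB δ (1 ⊗ₜ x) - (1 ⊗ₜ x) ⊗ₜ 1 ∈ leftFactors Q (H ⊗[ℂ] B) := by
  let ιH : H →ₐ[ℂ] H ⊗[ℂ] B := includeLeft
  let ιB : B →ₐ[ℂ] H ⊗[ℂ] B := includeRight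
  have hmap {p : B ⊗[ℂ] H} (hp : p ∈ leftFactors P H) : map ιB ιH p ∈ leftFactors Q (H ⊗[ℂ] B) :=
    map_mem_leftFactors hP ιH.toLinearMap hp
  have htwist : leftFactors P B ≤ (leftFactors Q (H ⊗[ℂ] B)).comap (smashTwist δ ιH ιB) :=
    leftFactors_le.2 fun p hp y => mul_mem_leftFactors (mul_one Q).le (hmap (hδP hp))
      (tmul_mem_leftFactors (Submodule.one_le.1 le_rfl) (ιB y))
  have hsplit : smashComul ΔH ΔB δ (1 ⊗ₜ x) - (1 ⊗ₜ x) ⊗ₜ 1 =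
      smashTwist δ ιH ιB (ΔB x - x ⊗ₜ 1) + map ιB ιH (δ x - x ⊗ₜ 1) := by
    rw [← includeRight_apply, smashComul_includeRight, map_sub, map_sub, smashTwist_tmul, map_tmul,
      map_one, map_one, ← one_def, mul_one]
    exact (sub_add_sub_cancel ..).symm
  rw [hsplit]
  exact add_mem (htwist hΔ) (hmap hδ)

section Map

variable {H' B' : Type} [CommRing H'] [Algebra ℂ H'] [Ring B'] [Algebra ℂ B']
  {f : H →ₐ[ℂ] H'} {g : B →ₐ[ℂ] B'}

theorem smashComul_comp_map {ΔH : H →ₐ[ℂ] H ⊗[ℂ] H} {ΔB : B →ₐ[ℂ] B ⊗[ℂ] B}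
    {δ : B →ₐ[ℂ] B ⊗[ℂ] H} {ΔH' : H' →ₐ[ℂ] H' ⊗[ℂ] H'} {ΔB' : B' →ₐ[ℂ] B' ⊗[ℂ] B'}
    {δ' : B' →ₐ[ℂ] B' ⊗[ℂ] H'} (hf : ΔH'.comp f = (map f f).comp ΔH)
    (hg : ΔB'.comp g = (map g g).comp ΔB) (hδ : δ'.comp g = (map g f).comp δ) :
    (smashComul ΔH' ΔB' δ').comp (map f g) =
      (map (map f g) (map f g)).comp (smashComul ΔH ΔB δ) := by
  have hl : (map f g).comp includeLeft = includeLeft.comp f := map_comp_includeLeft f g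
  have hr : (map f g).comp includeRight = includeRight.comp g := map_comp_includeRight f g
  have htwist (z : B ⊗[ℂ] B) : smashTwist δ' includeLeft includeRight (map g g z) =
      map (map f g) (map f g) (smashTwist δ includeLeft includeRight z) := by
    induction z with
    | zero => simp only [map_zero]
    | add z w hz hw => simp only [map_add, hz, hw]
    | tmul x y =>
      have hδx : map includeRight includeLeft (δ' (g x)) =
          map (map f g) (map f g) (map includeRight includeLeft (δ x)) := by
        rw [← AlgHom.comp_apply δ', hδ, AlgHom.comp_apply, ← AlgHom.comp_apply (map _ _),
          ← map_comp, ← hl, ← hr, map_comp, AlgHom.comp_apply]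
      rw [map_tmul, smashTwist_tmul, smashTwist_tmul, hδx, map_mul, map_tmul _ _ 1, map_one,
        ← AlgHom.comp_apply _ g, ← hr, AlgHom.comp_apply]
  refine Algebra.TensorProduct.ext ?_ (AlgHom.ext fun b => ?_)
  · rw [AlgHom.comp_assoc, hl, ← AlgHom.comp_assoc, smashComul_comp_includeLeft, AlgHom.comp_assoc,
      hf, ← AlgHom.comp_assoc, ← map_comp, ← hl, map_comp, AlgHom.comp_assoc,
      ← smashComul_comp_includeLeft ΔH ΔB δ]
    rfl
  · have hgb : ΔB' (g b) = map g g (ΔB b) := DFunLike.congr_fun hg b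
    calc _ = smashComul ΔH' ΔB' δ' (includeRight (g b)) :=
          congrArg _ (DFunLike.congr_fun hr b)
      _ = map (map f g) (map f g) (smashComul ΔH ΔB δ (includeRight b)) := by
        rw [smashComul_includeRight, smashComul_includeRight, hgb, htwist]
      _ = _ := rfl

theorem smashCounit_comp_map {εH : H →ₐ[ℂ] ℂ} {εB : B →ₐ[ℂ] ℂ} {εH' : H' →ₐ[ℂ] ℂ}
    {εB' : B' →ₐ[ℂ] ℂ} (hf : εH'.comp f = εH) (hg : εB'.comp g = εB) :
    (smashCounit εH' εB').comp (map f g) = smashCounit εH εB := by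
  subst hf hg
  exact Algebra.TensorProduct.ext' fun _ _ => rfl

end Map

end Smash

/-! ### The co-products on trees -/

section Trees

open Algebra.TensorProduct

theorem linearExt_tree {M : Type} [AddCommMonoid M] [Module ℂ M] (f : PBT → M) (t : PBT) :
    linearExt f (tree t) = f t :=
  (MonoidAlgebra.basis PBT ℂ).constr_basis ℂ f t

theorem treeAlg_induction {p : TreeAlg → Prop} (x : TreeAlg) (tree : ∀ t, p (tree t))
    (add : ∀ x y, p x → p y → p (x + y)) (smul : ∀ (c : ℂ) x, p x → p (c • x)) : p x :=
  MonoidAlgebra.induction_on x tree add smul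

theorem treeAlg_hom_ext {M : Type} [AddCommMonoid M] [Module ℂ M] {f g : TreeAlg →ₗ[ℂ] M}
    (h : ∀ t, f (tree t) = g (tree t)) : f = g :=
  (MonoidAlgebra.basis PBT ℂ).ext h

theorem tree_nil : tree .nil = 1 := rfl

theorem tree_mul_V (t s : PBT) : tree t * tree (V s) = tree (.node () t s) :=
  (map_mul (MonoidAlgebra.of ℂ PBT) t (V s)).symm

/-- The linear extension of `V`. -/
def VLin : TreeAlg →ₗ[ℂ] TreeAlg := linearExt fun t => tree (V t)

theorem VLin_tree (t : PBT) : VLin (tree t) = tree (V t) := linearExt_tree _ t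

theorem VTensorId_tmul (x y : TreeAlg) : VTensorId (x ⊗ₜ y) = VLin x ⊗ₜ y := rfl

theorem rTensor_VTensorId {M : Type} [AddCommGroup M] [Module ℂ M] (f : TreeAlg →ₗ[ℂ] M)
    (y : TreeAlg ⊗[ℂ] TreeAlg) :
    f.rTensor TreeAlg (VTensorId y) = (f ∘ₗ VLin).rTensor TreeAlg y :=
  (LinearMap.rTensor_comp_apply TreeAlg f VLin y).symm

theorem lTensor_VTensorId {M : Type} [AddCommGroup M] [Module ℂ M] (f : TreeAlg →ₗ[ℂ] M)
    (y : TreeAlg ⊗[ℂ] TreeAlg) :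
    f.lTensor TreeAlg (VTensorId y) = VLin.rTensor M (f.lTensor TreeAlg y) :=
  DFunLike.congr_fun
    ((LinearMap.lTensor_comp_rTensor _ VLin f).trans
      (LinearMap.rTensor_comp_lTensor _ VLin f).symm) y

/-- `x ⊗ y ↦ x ⊗ 1 ⊗ y`. -/
def insertMid : TreeAlg ⊗[ℂ] TreeAlg →ₐ[ℂ] (TreeAlg ⊗[ℂ] TreeAlg) ⊗[ℂ] TreeAlg :=
  map includeLeft (.id ℂ TreeAlg)

/-- `x ⊗ y ↦ 1 ⊗ x ⊗ y`. -/
def insertLeft : TreeAlg ⊗[ℂ] TreeAlg →ₐ[ℂ] (TreeAlg ⊗[ℂ] TreeAlg) ⊗[ℂ] TreeAlg :=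
  map includeRight (.id ℂ TreeAlg)

theorem assoc_insertLeft (y : TreeAlg ⊗[ℂ] TreeAlg) :
    Algebra.TensorProduct.assoc ℂ ℂ ℂ TreeAlg TreeAlg TreeAlg (insertLeft y) = 1 ⊗ₜ y := by
  induction y with
  | zero => simp only [map_zero, TensorProduct.tmul_zero]
  | add x y hx hy => simp only [map_add, TensorProduct.tmul_add, hx, hy]
  | tmul x y => rfl

theorem assoc_VTensorId_rTensor (y : (TreeAlg ⊗[ℂ] TreeAlg) ⊗[ℂ] TreeAlg) :
    Algebra.TensorProduct.assoc ℂ ℂ ℂ TreeAlg TreeAlg TreeAlg (VTensorId.rTensor TreeAlg y) =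
      VLin.rTensor (TreeAlg ⊗[ℂ] TreeAlg)
        (Algebra.TensorProduct.assoc ℂ ℂ ℂ TreeAlg TreeAlg TreeAlg y) := by
  induction y with
  | zero => simp only [map_zero]
  | add x y hx hy => simp only [map_add, hx, hy]
  | tmul w z =>
    induction w with
    | zero => simp only [map_zero, TensorProduct.zero_tmul]
    | add x y hx hy => simp only [map_add, TensorProduct.add_tmul, hx, hy]
    | tmul x y => rfl

theorem treeComul_over (t s : PBT) :
    treeComul (overProd t s) = treeComul t * treeComul s := by
  induction s with
  | nil => rw [treeComul_nil, tree_nil_tmul, mul_one]; rfl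
  | node _ r s hr _ => rw [overProd, treeComul_node, treeComul_node, hr, mul_assoc]

/-- The co-product `Δ^α` as an algebra homomorphism. -/
def treeComulHom : TreeAlg →ₐ[ℂ] TreeAlg ⊗[ℂ] TreeAlg :=
  MonoidAlgebra.lift ℂ (TreeAlg ⊗[ℂ] TreeAlg) PBT
    { toFun := treeComul, map_one' := rfl, map_mul' := treeComul_over }

theorem treeComulHom_tree (t : PBT) : treeComulHom (tree t) = treeComul t :=
  MonoidAlgebra.lift_of _ t

/-- The linear extension of the co-action `δ^α`, which is not multiplicative. -/
def treeCoactionLin : TreeAlg →ₗ[ℂ] TreeAlg ⊗[ℂ] TreeAlg := linearExt treeCoaction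

theorem treeCoactionLin_tree (t : PBT) : treeCoactionLin (tree t) = treeCoaction t :=
  linearExt_tree _ t

theorem treeCoactionLin_comp_VLin : treeCoactionLin ∘ₗ VLin = VTensorId ∘ₗ treeCoactionLin := by
  refine treeAlg_hom_ext fun t => ?_
  rw [LinearMap.comp_apply, LinearMap.comp_apply, VLin_tree, treeCoactionLin_tree, treeCoaction_V,
    treeCoactionLin_tree]

theorem treeComulHom_VLin (x : TreeAlg) :
    treeComulHom (VLin x) = 1 ⊗ₜ VLin x + VTensorId (treeCoactionLin x) := by
  induction x using treeAlg_induction with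
  | tree t =>
    rw [VLin_tree, treeComulHom_tree, treeComul_V, treeCoactionLin_tree, treeCoaction_V, tree_nil]
  | add x y hx hy => simp only [map_add, hx, hy, TensorProduct.tmul_add]; abel
  | smul c x hx => simp only [map_smul, hx, TensorProduct.tmul_smul, smul_add]

theorem treeCoactionLin_mul_VLin (x y : TreeAlg) :
    treeCoactionLin (x * VLin y) = treeComulHom x * VTensorId (treeCoactionLin y) := by
  induction x using treeAlg_induction with
  | add x y hx hy => simp only [map_add, hx, hy, add_mul]
  | smul c x hx => simp only [map_smul, hx, smul_mul_assoc]
  | tree r =>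
    induction y using treeAlg_induction with
    | add x y hx hy => simp only [map_add, hx, hy, mul_add]
    | smul c x hx => simp only [map_smul, hx, mul_smul_comm]
    | tree s =>
      rw [VLin_tree, tree_mul_V, treeCoactionLin_tree, treeCoaction_node, treeComulHom_tree,
        treeCoactionLin_tree, treeCoaction_V]

section Coassoc

theorem treeCoactionLin_rTensor_VTensorId (y : TreeAlg ⊗[ℂ] TreeAlg) :
    treeCoactionLin.rTensor TreeAlg (VTensorId y) =
      VTensorId.rTensor TreeAlg (treeCoactionLin.rTensor TreeAlg y) := by
  rw [rTensor_VTensorId, treeCoactionLin_comp_VLin, LinearMap.rTensor_comp_apply]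

theorem treeCoactionLin_rTensor_mul_VTensorId (x y : TreeAlg ⊗[ℂ] TreeAlg) :
    treeCoactionLin.rTensor TreeAlg (x * VTensorId y) =
      map treeComulHom (.id ℂ TreeAlg) x * treeCoactionLin.rTensor TreeAlg (VTensorId y) := by
  induction x with
  | zero => simp only [map_zero, zero_mul]
  | add x y hx hy => simp only [map_add, hx, hy, add_mul]
  | tmul p q =>
    induction y with
    | zero => simp only [map_zero, mul_zero]
    | add x y hx hy => simp only [map_add, hx, hy, mul_add]
    | tmul u v =>
      have hV : treeCoactionLin (VLin u) = VTensorId (treeCoactionLin u) :=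
        DFunLike.congr_fun treeCoactionLin_comp_VLin u
      rw [VTensorId_tmul, tmul_mul_tmul, LinearMap.rTensor_tmul, LinearMap.rTensor_tmul, map_tmul,
        tmul_mul_tmul, treeCoactionLin_mul_VLin, hV, AlgHom.id_apply]

theorem map_treeComulHom_id_VTensorId (y : TreeAlg ⊗[ℂ] TreeAlg) :
    map treeComulHom (.id ℂ TreeAlg) (VTensorId y) =
      insertLeft (VTensorId y) + VTensorId.rTensor TreeAlg (treeCoactionLin.rTensor TreeAlg y) := by
  induction y with
  | zero => simp only [map_zero, add_zero]
  | add x y hx hy => simp only [map_add, hx, hy]; abel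
  | tmul u v =>
    rw [VTensorId_tmul, map_tmul, treeComulHom_VLin, TensorProduct.add_tmul]
    rfl

theorem map_id_treeComulHom_VTensorId (y : TreeAlg ⊗[ℂ] TreeAlg) :
    map (.id ℂ TreeAlg) treeComulHom (VTensorId y) =
      VLin.rTensor (TreeAlg ⊗[ℂ] TreeAlg) (map (.id ℂ TreeAlg) treeComulHom y) :=
  lTensor_VTensorId treeComulHom.toLinearMap y

theorem treeComul_coassoc_and_treeCoaction_coassoc (t : PBT) :
    Algebra.TensorProduct.assoc ℂ ℂ ℂ TreeAlg TreeAlg TreeAlg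
        (map treeComulHom (.id ℂ TreeAlg) (treeComul t)) =
          map (.id ℂ TreeAlg) treeComulHom (treeComul t) ∧
      Algebra.TensorProduct.assoc ℂ ℂ ℂ TreeAlg TreeAlg TreeAlg
        (treeCoactionLin.rTensor TreeAlg (treeCoaction t)) =
          map (.id ℂ TreeAlg) treeComulHom (treeCoaction t) := by
  induction t with
  | nil =>
    rw [treeComul_nil, treeCoaction_nil, map_tmul, map_tmul, LinearMap.rTensor_tmul,
      treeComulHom_tree, treeCoactionLin_tree]
    exact ⟨rfl, rfl⟩
  | node _ r s hr hs =>
    have hV : Algebra.TensorProduct.assoc ℂ ℂ ℂ TreeAlg TreeAlg TreeAlg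
        (VTensorId.rTensor TreeAlg (treeCoactionLin.rTensor TreeAlg (treeCoaction s))) =
          map (.id ℂ TreeAlg) treeComulHom (VTensorId (treeCoaction s)) := by
      rw [assoc_VTensorId_rTensor, hs.2, map_id_treeComulHom_VTensorId]
    have hΔV : Algebra.TensorProduct.assoc ℂ ℂ ℂ TreeAlg TreeAlg TreeAlg
        (map treeComulHom (.id ℂ TreeAlg) (treeComul (V s))) =
          map (.id ℂ TreeAlg) treeComulHom (treeComul (V s)) := by
      rw [treeComul_V, map_add, map_add, map_add, treeCoaction_V, map_treeComulHom_id_VTensorId,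
        map_add, hV, assoc_insertLeft, map_tmul, map_tmul, tree_nil, map_one, treeComulHom_tree,
        treeComul_V, treeCoaction_V, TensorProduct.tmul_add, tree_nil, add_assoc]
      rfl
    constructor
    · rw [treeComul_node, map_mul, map_mul, map_mul, hr.1, hΔV]
    · rw [treeCoaction_node, treeCoaction_V, treeCoactionLin_rTensor_mul_VTensorId, map_mul, hr.1,
        treeCoactionLin_rTensor_VTensorId, hV, map_mul]

end Coassoc

section Counit

theorem toHalpha_tree (t : PBT) : toHalpha (tree t) = treeClass t := MonoidAlgebra.lift_of _ t

/-- The co-unit on trees, common to the co-product `Δ^α` and to the one dual to the under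
product. -/
def treeCounit : TreeAlg →ₐ[ℂ] ℂ := alphaCounit.comp toHalpha

theorem treeCounit_tree_node (r s : PBT) : treeCounit (tree (.node () r s)) = 0 := by
  rw [treeCounit, AlgHom.comp_apply, toHalpha_tree, treeClass, map_mul, alphaCounit,
    MvPolynomial.aeval_X, mul_zero]

theorem treeCounit_comp_VLin : treeCounit.toLinearMap ∘ₗ VLin = 0 := by
  refine treeAlg_hom_ext fun t => ?_
  rw [LinearMap.comp_apply, VLin_tree, V, AlgHom.toLinearMap_apply, treeCounit_tree_node,
    LinearMap.zero_apply]

theorem map_treeCounit_id_VTensorId (y : TreeAlg ⊗[ℂ] TreeAlg) :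
    map treeCounit (.id ℂ TreeAlg) (VTensorId y) = 0 := by
  refine (rTensor_VTensorId treeCounit.toLinearMap y).trans ?_
  rw [treeCounit_comp_VLin, LinearMap.rTensor_zero, LinearMap.zero_apply]

theorem map_id_treeCounit_VTensorId (y : TreeAlg ⊗[ℂ] TreeAlg) :
    map (.id ℂ TreeAlg) treeCounit (VTensorId y) =
      VLin.rTensor ℂ (map (.id ℂ TreeAlg) treeCounit y) :=
  lTensor_VTensorId treeCounit.toLinearMap y

theorem map_treeCounit_id_treeCoaction (t : PBT) :
    map treeCounit (.id ℂ TreeAlg) (treeCoaction t) = treeCounit (tree t) ⊗ₜ 1 := by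
  cases t with
  | nil => rfl
  | node _ r s =>
    rw [treeCoaction_node, treeCoaction_V, map_mul, map_treeCounit_id_VTensorId, mul_zero,
      treeCounit_tree_node, TensorProduct.zero_tmul]

theorem map_treeCounit_id_treeComul (t : PBT) :
    map treeCounit (.id ℂ TreeAlg) (treeComul t) = 1 ⊗ₜ tree t := by
  induction t with
  | nil => rw [treeComul_nil, map_tmul, tree_nil, map_one, map_one]
  | node _ r s hr _ =>
    rw [treeComul_node, treeComul_V, map_mul, hr, treeCoaction_V, map_add,
      map_treeCounit_id_VTensorId, map_tmul, tree_nil, map_one, add_zero, tmul_mul_tmul,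
      AlgHom.id_apply, tree_mul_V, mul_one]

theorem map_id_treeCounit_treeComul_and_treeCoaction (t : PBT) :
    map (.id ℂ TreeAlg) treeCounit (treeComul t) = tree t ⊗ₜ 1 ∧
      map (.id ℂ TreeAlg) treeCounit (treeCoaction t) = tree t ⊗ₜ 1 := by
  induction t with
  | nil =>
    rw [treeComul_nil, treeCoaction_nil, map_tmul, tree_nil, map_one treeCounit, map_one]
    exact ⟨rfl, rfl⟩
  | node _ r s hr hs =>
    have hV : map (.id ℂ TreeAlg) treeCounit (VTensorId (treeCoaction s)) =
        tree (V s) ⊗ₜ 1 := by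
      rw [map_id_treeCounit_VTensorId, hs.2, LinearMap.rTensor_tmul, VLin_tree]
    constructor
    · rw [treeComul_node, treeComul_V, treeCoaction_V, map_mul, map_add, hV, hr.1, map_tmul,
        V, treeCounit_tree_node, TensorProduct.tmul_zero, zero_add, ← V, tmul_mul_tmul,
        tree_mul_V, mul_one]
    · rw [treeCoaction_node, treeCoaction_V, map_mul, hV, hr.1, tmul_mul_tmul, tree_mul_V,
        mul_one]

end Counit

section Under

set_option maxSynthPendingDepth 6

/-- The linear extension of the co-product dual to the under product. -/
def underComulLin : TreeAlg →ₗ[ℂ] TreeAlg ⊗[ℂ] TreeAlg := linearExt underComul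

theorem underComulLin_tree (t : PBT) : underComulLin (tree t) = underComul t := linearExt_tree _ t

theorem underComulLin_one : underComulLin 1 = 1 := underComulLin_tree .nil

theorem linearExt_tree_node (r : PBT) (x : TreeAlg) :
    linearExt (fun t => tree (.node () r t)) x = tree r * VLin x := by
  induction x using treeAlg_induction with
  | tree s => rw [linearExt_tree, VLin_tree, tree_mul_V]
  | add x y hx hy => simp only [map_add, hx, hy, mul_add]
  | smul c x hx => simp only [map_smul, hx, mul_smul_comm]

theorem underComul_node (r s : PBT) : underComul (.node () r s) =
    1 ⊗ₜ tree (.node () r s) + (tree r ⊗ₜ 1) * VTensorId (underComul s) := by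
  rw [underComul, tree_nil]
  congr 1
  induction underComul s with
  | zero => simp only [map_zero, mul_zero]
  | add x y hx hy => simp only [map_add, hx, hy, mul_add]
  | tmul u v =>
    rw [TensorProduct.map_tmul, VTensorId_tmul, tmul_mul_tmul, one_mul, LinearMap.id_apply,
      linearExt_tree_node]

theorem underComulLin_mul_VLin (x y : TreeAlg) :
    underComulLin (x * VLin y) =
      1 ⊗ₜ (x * VLin y) + (x ⊗ₜ 1) * VTensorId (underComulLin y) := by
  induction x using treeAlg_induction with
  | add x y hx hy =>
    simp only [map_add, hx, hy, add_mul, TensorProduct.tmul_add, TensorProduct.add_tmul]; abel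
  | smul c x hx =>
    simp only [map_smul, hx, smul_mul_assoc, TensorProduct.tmul_smul, smul_add,
      ← TensorProduct.smul_tmul']
  | tree r =>
    induction y using treeAlg_induction with
    | add x y hx hy => simp only [map_add, hx, hy, mul_add, TensorProduct.tmul_add]; abel
    | smul c x hx => simp only [map_smul, hx, mul_smul_comm, TensorProduct.tmul_smul, smul_add]
    | tree s => rw [VLin_tree, tree_mul_V, underComulLin_tree, underComul_node, underComulLin_tree]

theorem underComulLin_rTensor_mul_VTensorId (w z : TreeAlg ⊗[ℂ] TreeAlg) :
    underComulLin.rTensor TreeAlg (w * VTensorId z) =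
      insertLeft (w * VTensorId z) +
        insertMid w * VTensorId.rTensor TreeAlg (underComulLin.rTensor TreeAlg z) := by
  induction w with
  | zero => simp only [map_zero, zero_mul, add_zero]
  | add x y hx hy => simp only [map_add, hx, hy, add_mul]; abel
  | tmul p q =>
    induction z with
    | zero => simp only [map_zero, mul_zero, add_zero]
    | add x y hx hy => simp only [map_add, hx, hy, mul_add]; abel
    | tmul u v =>
      rw [VTensorId_tmul, tmul_mul_tmul, LinearMap.rTensor_tmul, underComulLin_mul_VLin,
        LinearMap.rTensor_tmul, LinearMap.rTensor_tmul, insertMid, map_tmul, tmul_mul_tmul,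
        TensorProduct.add_tmul]
      rfl

theorem underComulLin_lTensor_tmul_one_mul (x : TreeAlg) (z : TreeAlg ⊗[ℂ] TreeAlg) :
    underComulLin.lTensor TreeAlg ((x ⊗ₜ 1) * z) =
      (x ⊗ₜ 1) * underComulLin.lTensor TreeAlg z := by
  induction z with
  | zero => simp only [map_zero, mul_zero]
  | add p q hp hq => simp only [map_add, mul_add, hp, hq]
  | tmul u v =>
    rw [tmul_mul_tmul, one_mul, LinearMap.lTensor_tmul, LinearMap.lTensor_tmul, tmul_mul_tmul,
      one_mul]

theorem underComul_coassoc (t : PBT) :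
    Algebra.TensorProduct.assoc ℂ ℂ ℂ TreeAlg TreeAlg TreeAlg
        (underComulLin.rTensor TreeAlg (underComul t)) =
      underComulLin.lTensor TreeAlg (underComul t) := by
  induction t with
  | nil =>
    rw [underComul, LinearMap.rTensor_tmul, LinearMap.lTensor_tmul, underComulLin_tree, underComul]
    rfl
  | node _ r s _ hs =>
    have hleft : Algebra.TensorProduct.assoc ℂ ℂ ℂ TreeAlg TreeAlg TreeAlg
        (underComulLin.rTensor TreeAlg ((tree r ⊗ₜ 1) * VTensorId (underComul s))) =
          1 ⊗ₜ ((tree r ⊗ₜ 1) * VTensorId (underComul s)) +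
            (tree r ⊗ₜ 1) * VLin.rTensor _ (underComulLin.lTensor TreeAlg (underComul s)) := by
      rw [underComulLin_rTensor_mul_VTensorId, map_add, assoc_insertLeft, map_mul,
        assoc_VTensorId_rTensor, hs]
      rfl
    have hright : underComulLin.lTensor TreeAlg ((tree r ⊗ₜ 1) * VTensorId (underComul s)) =
        (tree r ⊗ₜ 1) * VLin.rTensor _ (underComulLin.lTensor TreeAlg (underComul s)) := by
      rw [underComulLin_lTensor_tmul_one_mul, lTensor_VTensorId]
    rw [underComul_node, map_add, map_add, map_add, hleft, hright, ← add_assoc,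
      LinearMap.rTensor_tmul, LinearMap.lTensor_tmul, underComulLin_tree, underComulLin_one,
      underComul_node, TensorProduct.tmul_add]
    rfl

theorem map_treeCounit_id_underComul (t : PBT) :
    map treeCounit (.id ℂ TreeAlg) (underComul t) = 1 ⊗ₜ tree t := by
  cases t with
  | nil => rw [underComul, map_tmul, tree_nil, map_one, map_one]
  | node _ r s =>
    rw [underComul_node, map_add, map_mul, map_treeCounit_id_VTensorId, mul_zero, add_zero,
      map_tmul, map_one, AlgHom.id_apply]

theorem map_id_treeCounit_underComul (t : PBT) :
    map (.id ℂ TreeAlg) treeCounit (underComul t) = tree t ⊗ₜ 1 := by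
  induction t with
  | nil => rw [underComul, map_tmul, tree_nil, map_one treeCounit, map_one]
  | node _ r s _ hs =>
    rw [underComul_node, map_add, map_mul, map_id_treeCounit_VTensorId, hs, map_tmul,
      treeCounit_tree_node, TensorProduct.tmul_zero, zero_add, map_tmul, map_one,
      LinearMap.rTensor_tmul, VLin_tree, tmul_mul_tmul, AlgHom.id_apply, tree_mul_V, one_mul]

/-- `(x ⊗ y) ⊗ (u ⊗ v) ↦ (x ⊗ u) ⊗ y v`, the analogue of `coactionMul` for the non-commutative
algebra of trees; it is only linear. -/
def mulRight : (TreeAlg ⊗[ℂ] TreeAlg) ⊗[ℂ] (TreeAlg ⊗[ℂ] TreeAlg) →ₗ[ℂ]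
    (TreeAlg ⊗[ℂ] TreeAlg) ⊗[ℂ] TreeAlg :=
  (LinearMap.mul' ℂ TreeAlg).lTensor _ ∘ₗ
    (TensorProduct.tensorTensorTensorComm ℂ TreeAlg TreeAlg TreeAlg TreeAlg).toLinearMap

theorem mulRight_tmul (x y u v : TreeAlg) :
    mulRight ((x ⊗ₜ y) ⊗ₜ (u ⊗ₜ v)) = (x ⊗ₜ u) ⊗ₜ (y * v) := rfl

theorem mulRight_one_tmul (y : TreeAlg ⊗[ℂ] TreeAlg) : mulRight (1 ⊗ₜ y) = insertLeft y := by
  induction y with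
  | zero => simp only [map_zero, TensorProduct.tmul_zero]
  | add p q hp hq => simp only [map_add, TensorProduct.tmul_add, hp, hq]
  | tmul u v =>
    rw [Algebra.TensorProduct.one_def, mulRight_tmul, one_mul]
    rfl

theorem mulRight_mul_VTensorId_tmul (w z y : TreeAlg ⊗[ℂ] TreeAlg) :
    mulRight ((w * VTensorId z) ⊗ₜ y) =
      insertMid w * VTensorId.rTensor TreeAlg (mulRight (z ⊗ₜ y)) := by
  induction w with
  | zero => simp only [map_zero, zero_mul, TensorProduct.zero_tmul]
  | add p q hp hq => simp only [map_add, add_mul, TensorProduct.add_tmul, hp, hq]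
  | tmul a b =>
    induction z with
    | zero => simp only [map_zero, mul_zero, TensorProduct.zero_tmul]
    | add p q hp hq => simp only [map_add, mul_add, TensorProduct.add_tmul, hp, hq]
    | tmul c d =>
      induction y with
      | zero => simp only [map_zero, mul_zero, TensorProduct.tmul_zero]
      | add p q hp hq => simp only [map_add, mul_add, TensorProduct.tmul_add, hp, hq]
      | tmul e f =>
        rw [VTensorId_tmul, tmul_mul_tmul, mulRight_tmul, mulRight_tmul, LinearMap.rTensor_tmul,
          VTensorId_tmul, insertMid, map_tmul, tmul_mul_tmul, includeLeft_apply, tmul_mul_tmul,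
          one_mul, mul_assoc, AlgHom.id_apply]

theorem mulRight_map_treeCoactionLin_tmul_one_mul_VTensorId (r : PBT)
    (y : TreeAlg ⊗[ℂ] TreeAlg) :
    mulRight (TensorProduct.map treeCoactionLin treeCoactionLin ((tree r ⊗ₜ 1) * VTensorId y)) =
      insertMid (treeComul r) * VTensorId.rTensor TreeAlg
        (mulRight (TensorProduct.map treeCoactionLin treeCoactionLin y)) := by
  induction y with
  | zero => simp only [map_zero, mul_zero]
  | add p q hp hq => simp only [map_add, mul_add, hp, hq]
  | tmul u v =>
    rw [VTensorId_tmul, tmul_mul_tmul, one_mul, TensorProduct.map_tmul, treeCoactionLin_mul_VLin,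
      treeComulHom_tree, mulRight_mul_VTensorId_tmul, TensorProduct.map_tmul]

theorem underComulLin_rTensor_treeCoaction (t : PBT) :
    underComulLin.rTensor TreeAlg (treeCoaction t) =
      mulRight (TensorProduct.map treeCoactionLin treeCoactionLin (underComul t)) := by
  have hone : treeCoactionLin 1 = 1 := treeCoactionLin_tree .nil
  induction t with
  | nil =>
    rw [underComul, treeCoaction_nil, LinearMap.rTensor_tmul, TensorProduct.map_tmul, tree_nil,
      underComulLin_one, hone, mulRight_one_tmul, map_one]
    rfl
  | node _ r s _ hs =>
    rw [underComul_node, map_add, map_add, mulRight_map_treeCoactionLin_tmul_one_mul_VTensorId,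
      ← hs, TensorProduct.map_tmul, treeCoactionLin_tree, hone, mulRight_one_tmul,
      treeCoaction_node, treeCoaction_V, underComulLin_rTensor_mul_VTensorId]

end Under

end Trees

/-! ### From trees to `H^α` and `H^e` -/

section Generators

open Algebra.TensorProduct

variable {R C A : Type*} [CommSemiring R] [AddCommMonoid C] [Module R C] [Semiring A] [Algebra R A]

/-- `Δ` and `ε` make the module `C` a coalgebra. It is a predicate because the space of trees
carries two co-products. -/
structure IsCoalgebra (Δ : C →ₗ[R] C ⊗[R] C) (ε : C →ₗ[R] R) : Prop where
  coassoc : (TensorProduct.assoc R C C C).toLinearMap ∘ₗ Δ.rTensor C ∘ₗ Δ = Δ.lTensor C ∘ₗ Δ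
  rTensor : ε.rTensor C ∘ₗ Δ = (TensorProduct.lid R C).symm
  lTensor : ε.lTensor C ∘ₗ Δ = (TensorProduct.rid R C).symm

section Squares

variable {M N P Q M' N' : Type*} [AddCommMonoid M] [Module R M] [AddCommMonoid N] [Module R N]
  [AddCommMonoid P] [Module R P] [AddCommMonoid Q] [Module R Q] [AddCommMonoid M'] [Module R M']
  [AddCommMonoid N'] [Module R N'] {f : M →ₗ[R] N} {f' : N →ₗ[R] Q} {g : M →ₗ[R] P}
  {g' : P →ₗ[R] Q}

theorem rTensor_map_eq_of_comp_eq (h : f' ∘ₗ f = g' ∘ₗ g) (k : M' →ₗ[R] N') (z : M ⊗[R] M') :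
    f'.rTensor N' (TensorProduct.map f k z) = TensorProduct.map g' k (g.rTensor M' z) := by
  rw [LinearMap.rTensor, LinearMap.rTensor, TensorProduct.map_map, TensorProduct.map_map, h,
    LinearMap.id_comp, LinearMap.comp_id]

theorem lTensor_map_eq_of_comp_eq (h : f' ∘ₗ f = g' ∘ₗ g) (k : M' →ₗ[R] N') (z : M' ⊗[R] M) :
    f'.lTensor N' (TensorProduct.map k f z) = TensorProduct.map k g' (g.lTensor M' z) := by
  rw [LinearMap.lTensor, LinearMap.lTensor, TensorProduct.map_map, TensorProduct.map_map, h,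
    LinearMap.id_comp, LinearMap.comp_id]

end Squares

theorem IsCoalgebra.isBialgebra {Δ : C →ₗ[R] C ⊗[R] C} {ε : C →ₗ[R] R} (h : IsCoalgebra Δ ε)
    {ΔA : A →ₐ[R] A ⊗[R] A} {εA : A →ₐ[R] R} {π : C →ₗ[R] A}
    (hπ : Algebra.adjoin R (Set.range π) = ⊤)
    (hΔ : ΔA.toLinearMap ∘ₗ π = TensorProduct.map π π ∘ₗ Δ) (hε : εA.toLinearMap ∘ₗ π = ε) :
    IsBialgebra ΔA εA := by
  have hΔx (x : C) : ΔA (π x) = TensorProduct.map π π (Δ x) := DFunLike.congr_fun hΔ x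
  have hε' : εA.toLinearMap ∘ₗ π = LinearMap.id ∘ₗ ε := hε
  refine ⟨AlgHom.ext_of_adjoin_eq_top hπ ?_, AlgHom.ext_of_adjoin_eq_top hπ ?_,
    AlgHom.ext_of_adjoin_eq_top hπ ?_⟩ <;> rintro _ ⟨x, rfl⟩ <;>
    rw [AlgHom.comp_apply]
  · calc Algebra.TensorProduct.assoc R R R A A A (map ΔA (.id R A) (ΔA (π x)))
        = TensorProduct.assoc R A A A
            (ΔA.toLinearMap.rTensor A (TensorProduct.map π π (Δ x))) := by rw [hΔx]; rfl
      _ = TensorProduct.assoc R A A A (TensorProduct.map (TensorProduct.map π π) π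
            (Δ.rTensor C (Δ x))) := by rw [rTensor_map_eq_of_comp_eq hΔ]
      _ = TensorProduct.map π (TensorProduct.map π π) (Δ.lTensor C (Δ x)) := by
        rw [← TensorProduct.map_map_assoc]
        exact congrArg _ (DFunLike.congr_fun h.coassoc x)
      _ = ΔA.toLinearMap.lTensor A (TensorProduct.map π π (Δ x)) :=
        (lTensor_map_eq_of_comp_eq hΔ _ _).symm
      _ = map (.id R A) ΔA (ΔA (π x)) := by rw [hΔx]; rfl
  · calc map εA (.id R A) (ΔA (π x))
        = εA.toLinearMap.rTensor A (TensorProduct.map π π (Δ x)) := by rw [hΔx]; rfl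
      _ = π.lTensor R (ε.rTensor C (Δ x)) := rTensor_map_eq_of_comp_eq hε' _ _
      _ = π.lTensor R (1 ⊗ₜ x) := congrArg _ (DFunLike.congr_fun h.rTensor x)
  · calc map (.id R A) εA (ΔA (π x))
        = εA.toLinearMap.lTensor A (TensorProduct.map π π (Δ x)) := by rw [hΔx]; rfl
      _ = π.rTensor R (ε.lTensor C (Δ x)) := lTensor_map_eq_of_comp_eq hε' _ _
      _ = π.rTensor R (x ⊗ₜ 1) := congrArg _ (DFunLike.congr_fun h.lTensor x)

end Generators

section QED

open Algebra.TensorProduct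

theorem isCoalgebra_tree : IsCoalgebra treeComulHom.toLinearMap treeCounit.toLinearMap := by
  refine ⟨treeAlg_hom_ext fun t => ?_, treeAlg_hom_ext fun t => ?_, treeAlg_hom_ext fun t => ?_⟩
    <;> simp only [LinearMap.comp_apply, AlgHom.toLinearMap_apply, treeComulHom_tree]
  · exact (treeComul_coassoc_and_treeCoaction_coassoc t).1
  · exact map_treeCounit_id_treeComul t
  · exact (map_id_treeCounit_treeComul_and_treeCoaction t).1

theorem isCoalgebra_under : IsCoalgebra underComulLin treeCounit.toLinearMap := by
  refine ⟨treeAlg_hom_ext fun t => ?_, treeAlg_hom_ext fun t => ?_, treeAlg_hom_ext fun t => ?_⟩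
    <;> simp only [LinearMap.comp_apply, underComulLin_tree]
  · exact underComul_coassoc t
  · exact map_treeCounit_id_underComul t
  · exact map_id_treeCounit_underComul t

theorem toHalpha_tree_V (s : PBT) : toHalpha (tree (V s)) = MvPolynomial.X s := by
  rw [toHalpha_tree, V, treeClass, treeClass, one_mul]

theorem adjoin_range_toHalpha :
    Algebra.adjoin ℂ (Set.range toHalpha.toLinearMap) = ⊤ := by
  refine top_unique (MvPolynomial.adjoin_range_X.symm.trans_le (Algebra.adjoin_mono ?_))
  rintro _ ⟨s, rfl⟩
  exact ⟨tree (V s), toHalpha_tree_V s⟩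

theorem toHe_tree (t : PBT) : toHe (tree t) = treeGen t := linearExt_tree _ t

theorem toHe_one : toHe 1 = 1 := toHe_tree .nil

theorem adjoin_range_toHe : Algebra.adjoin ℂ (Set.range toHe) = ⊤ := by
  refine top_unique ((FreeAlgebra.adjoin_range_ι ℂ _).symm.trans_le (Algebra.adjoin_mono ?_))
  rintro _ ⟨⟨t, ht⟩, rfl⟩
  cases t with
  | nil => exact absurd rfl ht
  | node _ r s => exact ⟨tree (.node () r s), toHe_tree _⟩

theorem alphaComul_comp_toHalpha :
    alphaComul.comp toHalpha = (map toHalpha toHalpha).comp treeComulHom := by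
  refine AlgHom.toLinearMap_injective (treeAlg_hom_ext fun t => ?_)
  simp only [AlgHom.toLinearMap_apply, AlgHom.comp_apply]
  rw [toHalpha_tree, treeComulHom_tree]
  induction t with
  | nil => rw [treeClass, treeComul_nil, tree_nil_tmul, map_one, map_one]
  | node _ r s hr _ =>
    rw [treeClass, map_mul, hr, treeComul_node, map_mul, alphaComul, MvPolynomial.aeval_X]

theorem eComul_comp_toHe :
    eComul.toLinearMap ∘ₗ toHe = TensorProduct.map toHe toHe ∘ₗ underComulLin := by
  refine treeAlg_hom_ext fun t => ?_
  rw [LinearMap.comp_apply, LinearMap.comp_apply, underComulLin_tree, AlgHom.toLinearMap_apply,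
    toHe_tree]
  cases t with
  | nil => rw [underComul, TensorProduct.map_tmul, toHe_tree, treeGen, map_one]; rfl
  | node _ r s => rw [treeGen, eComul, FreeAlgebra.lift_ι_apply]

theorem eCoaction_comp_toHe : eCoaction.toLinearMap ∘ₗ toHe =
    TensorProduct.map toHe toHalpha.toLinearMap ∘ₗ treeCoactionLin := by
  refine treeAlg_hom_ext fun t => ?_
  rw [LinearMap.comp_apply, LinearMap.comp_apply, treeCoactionLin_tree, AlgHom.toLinearMap_apply,
    toHe_tree]
  cases t with
  | nil =>
    rw [treeCoaction_nil, TensorProduct.map_tmul, tree_nil, toHe_one, AlgHom.toLinearMap_apply,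
      map_one, treeGen, map_one]
    rfl
  | node _ r s => rw [treeGen, eCoaction, FreeAlgebra.lift_ι_apply]

theorem eCounit_comp_toHe : eCounit.toLinearMap ∘ₗ toHe = treeCounit.toLinearMap := by
  refine treeAlg_hom_ext fun t => ?_
  rw [LinearMap.comp_apply, toHe_tree, AlgHom.toLinearMap_apply, AlgHom.toLinearMap_apply]
  cases t with
  | nil => rw [treeGen, map_one, tree_nil, map_one]
  | node _ r s => rw [treeGen, eCounit, FreeAlgebra.lift_ι_apply, treeCounit_tree_node]

theorem isBialgebra_alpha : IsBialgebra alphaComul alphaCounit :=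
  isCoalgebra_tree.isBialgebra adjoin_range_toHalpha
    (congrArg AlgHom.toLinearMap alphaComul_comp_toHalpha) rfl

theorem isBialgebra_e : IsBialgebra eComul eCounit :=
  isCoalgebra_under.isBialgebra adjoin_range_toHe eComul_comp_toHe eCounit_comp_toHe

theorem eCoaction_toHe_tree (t : PBT) : eCoaction (toHe (tree t)) =
    TensorProduct.map toHe toHalpha.toLinearMap (treeCoaction t) := by
  rw [← treeCoactionLin_tree]
  exact DFunLike.congr_fun eCoaction_comp_toHe (tree t)

theorem eComul_toHe_tree (t : PBT) :
    eComul (toHe (tree t)) = TensorProduct.map toHe toHe (underComul t) := by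
  rw [← underComulLin_tree]
  exact DFunLike.congr_fun eComul_comp_toHe (tree t)

theorem he_hom_ext {A : Type} [Semiring A] [Algebra ℂ A] {f g : He →ₐ[ℂ] A}
    (h : ∀ t, f (toHe (tree t)) = g (toHe (tree t))) : f = g := by
  refine AlgHom.ext_of_adjoin_eq_top adjoin_range_toHe ?_
  rintro _ ⟨x, rfl⟩
  exact DFunLike.congr_fun (treeAlg_hom_ext (f := f.toLinearMap ∘ₗ toHe)
    (g := g.toLinearMap ∘ₗ toHe) h) x

theorem coactionMul_map_map_eCoaction (w : TreeAlg ⊗[ℂ] TreeAlg) :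
    coactionMul Halpha He (map eCoaction eCoaction (TensorProduct.map toHe toHe w)) =
      TensorProduct.map (TensorProduct.map toHe toHe) toHalpha.toLinearMap
        (mulRight (TensorProduct.map treeCoactionLin treeCoactionLin w)) := by
  have hmul : (coactionMul Halpha He).toLinearMap ∘ₗ TensorProduct.map
        (TensorProduct.map toHe toHalpha.toLinearMap)
        (TensorProduct.map toHe toHalpha.toLinearMap) =
      TensorProduct.map (TensorProduct.map toHe toHe) toHalpha.toLinearMap ∘ₗ mulRight := by
    refine TensorProduct.ext_fourfold' fun x y u v => ?_
    exact congrArg (fun h => (toHe x ⊗ₜ[ℂ] toHe u) ⊗ₜ[ℂ] h) (map_mul toHalpha y v).symm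
  have hδ : map eCoaction eCoaction (TensorProduct.map toHe toHe w) =
      TensorProduct.map (TensorProduct.map toHe toHalpha.toLinearMap)
        (TensorProduct.map toHe toHalpha.toLinearMap)
        (TensorProduct.map treeCoactionLin treeCoactionLin w) := by
    rw [TensorProduct.map_map, ← eCoaction_comp_toHe, ← TensorProduct.map_map]
    rfl
  rw [hδ]
  exact DFunLike.congr_fun hmul _

theorem isComoduleBialgebra_e :
    IsComoduleBialgebra alphaComul alphaCounit eComul eCounit eCoaction := by
  refine ⟨he_hom_ext fun t => ?_, he_hom_ext fun t => ?_, he_hom_ext fun t => ?_,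
    he_hom_ext fun t => ?_⟩ <;>
    simp only [AlgHom.comp_apply, eCoaction_toHe_tree, eComul_toHe_tree]
  · have hleft := rTensor_map_eq_of_comp_eq eCoaction_comp_toHe toHalpha.toLinearMap
      (treeCoaction t)
    have hΔ : alphaComul.toLinearMap ∘ₗ toHalpha.toLinearMap =
        TensorProduct.map toHalpha.toLinearMap toHalpha.toLinearMap ∘ₗ treeComulHom.toLinearMap :=
      congrArg AlgHom.toLinearMap alphaComul_comp_toHalpha
    have hright := lTensor_map_eq_of_comp_eq hΔ toHe (treeCoaction t)
    refine (congrArg (TensorProduct.assoc ℂ He Halpha Halpha) hleft).trans (.trans ?_ hright.symm)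
    rw [← TensorProduct.map_map_assoc]
    exact congrArg _ (treeComul_coassoc_and_treeCoaction_coassoc t).2
  · refine (lTensor_map_eq_of_comp_eq (f' := alphaCounit.toLinearMap)
      (g := treeCounit.toLinearMap) (g' := .id) rfl toHe _).trans ?_
    exact congrArg (toHe.rTensor ℂ) (map_id_treeCounit_treeComul_and_treeCoaction t).2
  · rw [coactionMul_map_map_eCoaction, ← underComulLin_rTensor_treeCoaction]
    exact rTensor_map_eq_of_comp_eq eComul_comp_toHe _ _
  · refine (rTensor_map_eq_of_comp_eq (f' := eCounit.toLinearMap)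
      (g := treeCounit.toLinearMap) (g' := .id) eCounit_comp_toHe toHalpha.toLinearMap _).trans ?_
    refine (congrArg (toHalpha.toLinearMap.lTensor ℂ) (map_treeCounit_id_treeCoaction t)).trans ?_
    rw [LinearMap.lTensor_tmul, AlgHom.toLinearMap_apply, map_one]
    exact congrArg (· ⊗ₜ[ℂ] (1 : Halpha)) (DFunLike.congr_fun eCounit_comp_toHe (tree t)).symm

end QED

/-! ### Leading terms and conilpotency -/

section LeadingTerms

open Algebra.TensorProduct

/-- The span of the trees with less than `n` internal vertices. -/
def treesLT (n : ℕ) : Submodule ℂ TreeAlg := Submodule.span ℂ (tree '' {t | t.numNodes < n})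

theorem tree_mem_treesLT {t : PBT} {n : ℕ} (h : t.numNodes < n) : tree t ∈ treesLT n :=
  Submodule.subset_span ⟨t, h, rfl⟩

theorem treesLT_le {n : ℕ} {P : Submodule ℂ TreeAlg} :
    treesLT n ≤ P ↔ ∀ t : PBT, t.numNodes < n → tree t ∈ P := by
  rw [treesLT, Submodule.span_le, Set.image_subset_iff]
  rfl

theorem treesLT_mono {m n : ℕ} (h : m ≤ n) : treesLT m ≤ treesLT n :=
  treesLT_le.2 fun _ ht => tree_mem_treesLT (ht.trans_le h)

theorem numNodes_overProd (t s : PBT) :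
    (overProd t s).numNodes = t.numNodes + s.numNodes := by
  induction s with
  | nil => rfl
  | node _ r s hr _ => simp only [overProd, BinaryTree.numNodes, hr]; omega

theorem numNodes_V (t : PBT) : (V t).numNodes = t.numNodes + 1 := by
  simp only [V, BinaryTree.numNodes, zero_add]

theorem tree_mul (t s : PBT) : tree t * tree s = tree (overProd t s) :=
  (map_mul (MonoidAlgebra.of ℂ PBT) t s).symm

theorem treesLT_mul_le {m n k : ℕ} (h : m + n ≤ k + 1) : treesLT m * treesLT n ≤ treesLT k := by
  rw [treesLT, treesLT, Submodule.span_mul_span, Submodule.span_le]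
  rintro _ ⟨_, ⟨t, ht, rfl⟩, _, ⟨s, hs, rfl⟩, rfl⟩
  have hst : (overProd t s).numNodes < k := by
    rw [numNodes_overProd]
    have : t.numNodes < m := ht
    have : s.numNodes < n := hs
    omega
  exact (congrArg (· ∈ treesLT k) (tree_mul t s)).mpr (tree_mem_treesLT hst)

theorem treesLT_le_comap_VLin (n : ℕ) : treesLT n ≤ (treesLT (n + 1)).comap VLin :=
  treesLT_le.2 fun t ht => by
    rw [Submodule.mem_comap, VLin_tree]
    exact tree_mem_treesLT (by rw [numNodes_V]; omega)

/-- `w` has leading term `t ⊗ 1`: the left factors of the other terms have fewer internal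
vertices. -/
def HasLeading (t : PBT) (w : TreeAlg ⊗[ℂ] TreeAlg) : Prop :=
  w - tree t ⊗ₜ 1 ∈ leftFactors (treesLT t.numNodes) TreeAlg

theorem hasLeading_tmul_one (t : PBT) : HasLeading t (tree t ⊗ₜ 1) := by
  rw [HasLeading, sub_self]
  exact zero_mem _

theorem HasLeading.one_tmul_add {t : PBT} {w : TreeAlg ⊗[ℂ] TreeAlg} (h : HasLeading t w)
    (ht : 0 < t.numNodes) (x : TreeAlg) : HasLeading t (1 ⊗ₜ x + w) := by
  rw [HasLeading, add_sub_assoc]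
  exact add_mem (tmul_mem_leftFactors (tree_mem_treesLT (t := .nil) ht) x) h

theorem HasLeading.VTensorId {t : PBT} {w : TreeAlg ⊗[ℂ] TreeAlg} (h : HasLeading t w) :
    HasLeading (V t) (VTensorId w) := by
  rw [HasLeading, ← VLin_tree, ← VTensorId_tmul, ← map_sub, numNodes_V]
  exact map_mem_leftFactors (treesLT_le_comap_VLin _) .id h

theorem HasLeading.mul {t s : PBT} {w y : TreeAlg ⊗[ℂ] TreeAlg} (hw : HasLeading t w)
    (hy : HasLeading s y) : HasLeading (overProd t s) (w * y) := by
  have hleading (u : PBT) :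
      tree u ⊗ₜ[ℂ] (1 : TreeAlg) ∈ leftFactors (treesLT (u.numNodes + 1)) TreeAlg :=
    tmul_mem_leftFactors (tree_mem_treesLT (Nat.lt_succ_self _)) 1
  have hsplit : w * y - tree (overProd t s) ⊗ₜ 1 =
      (w - tree t ⊗ₜ 1) * (tree s ⊗ₜ 1) + (tree t ⊗ₜ 1) * (y - tree s ⊗ₜ 1) +
        (w - tree t ⊗ₜ 1) * (y - tree s ⊗ₜ 1) := by
    rw [← tree_mul, ← mul_one (1 : TreeAlg), ← tmul_mul_tmul, mul_one]
    simp only [mul_sub, sub_mul]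
    abel
  rw [HasLeading, hsplit, numNodes_overProd]
  exact add_mem (add_mem (mul_mem_leftFactors (treesLT_mul_le (by omega)) hw (hleading s))
    (mul_mem_leftFactors (treesLT_mul_le (by omega)) (hleading t) hy))
    (mul_mem_leftFactors (treesLT_mul_le (by omega)) hw hy)

theorem overProd_V (t s : PBT) : overProd t (V s) = .node () t s := rfl

theorem HasLeading.mul_V {t s : PBT} {w y : TreeAlg ⊗[ℂ] TreeAlg} (hw : HasLeading t w)
    (hy : HasLeading (V s) y) : HasLeading (.node () t s) (w * y) := by
  rw [← overProd_V]
  exact hw.mul hy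

theorem hasLeading_treeComul_and_treeCoaction (t : PBT) :
    HasLeading t (treeComul t) ∧ HasLeading t (treeCoaction t) := by
  induction t with
  | nil => exact ⟨hasLeading_tmul_one _, hasLeading_tmul_one _⟩
  | node _ r s hr hs =>
    have hV : HasLeading (V s) (treeCoaction (V s)) := by
      rw [treeCoaction_V]
      exact hs.2.VTensorId
    rw [treeComul_node, treeCoaction_node, treeComul_V]
    exact ⟨hr.1.mul_V (hV.one_tmul_add (Nat.succ_pos _) _), hr.1.mul_V hV⟩

theorem hasLeading_underComul (t : PBT) : HasLeading t (underComul t) := by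
  induction t with
  | nil => exact hasLeading_tmul_one _
  | node _ r s _ hs =>
    rw [underComul_node]
    exact ((hasLeading_tmul_one r).mul_V hs.VTensorId).one_tmul_add (Nat.succ_pos _) _

theorem treesLT_le_comap_treeCoactionLin (n : ℕ) :
    treesLT n ≤ (leftFactors (treesLT n) TreeAlg).comap treeCoactionLin :=
  treesLT_le.2 fun t ht => by
    rw [Submodule.mem_comap, treeCoactionLin_tree, ← sub_add_cancel (treeCoaction t) (tree t ⊗ₜ 1)]
    exact add_mem (leftFactors_mono (treesLT_mono ht.le)
        (hasLeading_treeComul_and_treeCoaction t).2)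
      (tmul_mem_leftFactors (tree_mem_treesLT ht) 1)

end LeadingTerms

section QEDHopfAlgebra

open Algebra.TensorProduct

theorem HasLeading.map_sub_mem {M N : Type} [AddCommGroup M] [Module ℂ M] [AddCommGroup N]
    [Module ℂ N] {t : PBT} {w : TreeAlg ⊗[ℂ] TreeAlg} (h : HasLeading t w) (f : TreeAlg →ₗ[ℂ] M)
    (g : TreeAlg →ₗ[ℂ] N) :
    TensorProduct.map f g w - f (tree t) ⊗ₜ g 1 ∈
      leftFactors ((treesLT t.numNodes).map f) N := by
  rw [← TensorProduct.map_tmul, ← map_sub]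
  exact map_mem_leftFactors (Submodule.le_comap_map f _) g h

theorem alphaComul_toHalpha_sub_mem (t : PBT) :
    alphaComul (toHalpha (tree t)) - toHalpha (tree t) ⊗ₜ 1 ∈
      leftFactors ((treesLT t.numNodes).map toHalpha.toLinearMap) Halpha := by
  rw [← map_one toHalpha, ← AlgHom.comp_apply, alphaComul_comp_toHalpha, AlgHom.comp_apply,
    treeComulHom_tree]
  exact (hasLeading_treeComul_and_treeCoaction t).1.map_sub_mem _ _

theorem eComul_toHe_sub_mem (t : PBT) :
    eComul (toHe (tree t)) - toHe (tree t) ⊗ₜ 1 ∈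
      leftFactors ((treesLT t.numNodes).map toHe) He := by
  rw [eComul_toHe_tree, ← toHe_one]
  exact (hasLeading_underComul t).map_sub_mem _ _

theorem eCoaction_toHe_sub_mem (t : PBT) :
    eCoaction (toHe (tree t)) - toHe (tree t) ⊗ₜ 1 ∈
      leftFactors ((treesLT t.numNodes).map toHe) Halpha := by
  rw [eCoaction_toHe_tree, ← map_one toHalpha]
  exact (hasLeading_treeComul_and_treeCoaction t).2.map_sub_mem _ toHalpha.toLinearMap

theorem map_toHe_treesLT_le_comap_eCoaction (n : ℕ) : (treesLT n).map toHe ≤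
    (leftFactors ((treesLT n).map toHe) Halpha).comap eCoaction.toLinearMap := by
  rw [Submodule.map_le_iff_le_comap, ← Submodule.comap_comp, eCoaction_comp_toHe]
  exact fun x hx => map_mem_leftFactors (Submodule.le_comap_map toHe _) _
    (treesLT_le_comap_treeCoactionLin n hx)

theorem subalgebra_eq_top_of_adjoin_eq_top {R H B : Type*} [CommSemiring R] [Semiring H]
    [Algebra R H] [Semiring B] [Algebra R B] {C : Subalgebra R (H ⊗[R] B)} {s : Set H} {t : Set B}
    (hs : Algebra.adjoin R s = ⊤) (ht : Algebra.adjoin R t = ⊤) (hsC : ∀ x ∈ s, x ⊗ₜ[R] 1 ∈ C)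
    (htC : ∀ y ∈ t, 1 ⊗ₜ[R] y ∈ C) : C = ⊤ := by
  have hH : ⊤ ≤ C.comap (includeLeft : H →ₐ[R] H ⊗[R] B) := hs ▸ Algebra.adjoin_le hsC
  have hB : ⊤ ≤ C.comap (includeRight : B →ₐ[R] H ⊗[R] B) := ht ▸ Algebra.adjoin_le htC
  rw [eq_top_iff, ← adjoin_tmul_eq_top, Algebra.adjoin_le_iff]
  rintro _ ⟨x, y, rfl⟩
  rw [← mul_one x, ← one_mul y, ← tmul_mul_tmul]
  exact mul_mem (hH trivial) (hB trivial)

theorem mem_of_forall_tree_mem {P : Submodule ℂ TreeAlg} (h : ∀ t, tree t ∈ P) (x : TreeAlg) :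
    x ∈ P :=
  treeAlg_induction x h (fun _ _ => P.add_mem) fun c _ => P.smul_mem c

theorem isBialgebra_qed : IsBialgebra qedComul qedCounit :=
  isBialgebra_alpha.smash isBialgebra_e isComoduleBialgebra_e

theorem isConilpotent_qed : let := isBialgebra_qed.bialgebra; IsConilpotent ℂ QEDSmash := by
  let := isBialgebra_qed.bialgebra
  have hα (n : ℕ) : ∀ t : PBT, t.numNodes = n →
      toHalpha (tree t) ⊗ₜ[ℂ] 1 ∈ conilSubalgebra ℂ QEDSmash := by
    induction n using Nat.strong_induction_on with
    | _ n ih =>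
      rintro t rfl
      refine mem_conilSubalgebra_of_comul (smashComul_includeLeft_sub_mem ?_
        (alphaComul_toHalpha_sub_mem t))
      exact Submodule.map_le_iff_le_comap.2 (treesLT_le.2 fun s hs => ih _ hs s rfl)
  have he (n : ℕ) : ∀ t : PBT, t.numNodes = n →
      1 ⊗ₜ[ℂ] toHe (tree t) ∈ conilSubalgebra ℂ QEDSmash := by
    induction n using Nat.strong_induction_on with
    | _ n ih =>
      rintro t rfl
      refine mem_conilSubalgebra_of_comul (smashComul_includeRight_sub_mem ?_
        (map_toHe_treesLT_le_comap_eCoaction _) (eComul_toHe_sub_mem t) (eCoaction_toHe_sub_mem t))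
      exact Submodule.map_le_iff_le_comap.2 (treesLT_le.2 fun s hs => ih _ hs s rfl)
  refine isConilpotent_of_conilSubalgebra_eq_top (subalgebra_eq_top_of_adjoin_eq_top
    adjoin_range_toHalpha adjoin_range_toHe ?_ ?_)
  · rintro _ ⟨x, rfl⟩
    exact mem_of_forall_tree_mem (P := (conilSubalgebra ℂ QEDSmash).toSubmodule.comap
      ((includeLeft : Halpha →ₐ[ℂ] QEDSmash).comp toHalpha).toLinearMap) (fun t => hα _ t rfl) x
  · rintro _ ⟨x, rfl⟩
    exact mem_of_forall_tree_mem (P := (conilSubalgebra ℂ QEDSmash).toSubmodule.comap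
      ((includeRight : He →ₐ[ℂ] QEDSmash).toLinearMap ∘ₗ toHe)) (fun t => he _ t rfl) x

theorem isHopf_qed : IsHopf qedComul qedCounit := isBialgebra_qed.isHopf isConilpotent_qed

end QEDHopfAlgebra

/-! ### Sums of trees -/

section TreeSums

open Finset Algebra.TensorProduct

theorem sum_antidiagonal_assoc {A M : Type*} [AddMonoid A] [HasAntidiagonal A] [AddCommMonoid M]
    (n : A) (f : A → A → A → M) :
    ∑ x ∈ antidiagonal n, ∑ y ∈ antidiagonal x.1, f y.1 y.2 x.2 =
      ∑ x ∈ antidiagonal n, ∑ y ∈ antidiagonal x.2, f x.1 y.1 y.2 := by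
  rw [sum_sigma', sum_sigma']
  refine sum_nbij' (fun x => ⟨(x.2.1, x.2.2 + x.1.2), (x.2.2, x.1.2)⟩)
    (fun x => ⟨(x.1.1 + x.2.1, x.2.2), (x.1.1, x.2.1)⟩) ?_ ?_ ?_ ?_ ?_ <;>
  simp +contextual <;> grind

theorem sum_antidiagonal_exchange {A M : Type*} [AddCommMonoid A] [HasAntidiagonal A]
    [AddCommMonoid M] (n : A) (f : A → A → A → A → M) :
    ∑ x ∈ antidiagonal n, ∑ y ∈ antidiagonal x.1, ∑ z ∈ antidiagonal x.2, f y.1 y.2 z.1 z.2 =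
      ∑ x ∈ antidiagonal n, ∑ y ∈ antidiagonal x.1, ∑ z ∈ antidiagonal x.2,
        f y.1 z.1 y.2 z.2 := by
  simp only [← sum_product', sum_sigma']
  let swap : (_ : A × A) × (A × A) × A × A → (_ : A × A) × (A × A) × A × A := fun x =>
    ⟨(x.2.1.1 + x.2.2.1, x.2.1.2 + x.2.2.2), (x.2.1.1, x.2.2.1), (x.2.1.2, x.2.2.2)⟩
  refine sum_nbij' swap swap ?_ ?_ ?_ ?_ ?_ <;>
  simp +contextual [swap] <;> grind

theorem sum_treesOfNumNodesEq_succ {M : Type*} [AddCommMonoid M] (n : ℕ) (f : PBT → M) :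
    ∑ t ∈ BinaryTree.treesOfNumNodesEq (n + 1), f t =
      ∑ x ∈ antidiagonal n, ∑ r ∈ BinaryTree.treesOfNumNodesEq x.1,
        ∑ s ∈ BinaryTree.treesOfNumNodesEq x.2, f (.node () r s) := by
  rw [BinaryTree.treesOfNumNodesEq_succ, sum_biUnion]
  · refine sum_congr rfl fun x _ => ?_
    rw [← sum_product', BinaryTree.pairwiseNode, sum_map]
    rfl
  · rintro ⟨i, j⟩ _ ⟨k, l⟩ _ hne
    refine disjoint_left.2 fun t h h' => hne ?_
    simp only [BinaryTree.pairwiseNode, mem_map, mem_product,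
      BinaryTree.mem_treesOfNumNodesEq] at h h'
    obtain ⟨⟨r, s⟩, ⟨rfl, rfl⟩, rfl⟩ := h
    obtain ⟨⟨r', s'⟩, ⟨rfl, rfl⟩, heq⟩ := h'
    obtain ⟨-, rfl, rfl⟩ := BinaryTree.node.inj heq
    rfl

theorem treeSum_zero : treeSum 0 = 1 := by
  rw [treeSum, BinaryTree.treesOfNumNodesEq_zero, sum_singleton, tree_nil]

theorem treeSum_succ (n : ℕ) :
    treeSum (n + 1) = ∑ x ∈ antidiagonal n, treeSum x.1 * VLin (treeSum x.2) := by
  rw [treeSum, sum_treesOfNumNodesEq_succ]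
  refine sum_congr rfl fun x _ => ?_
  simp only [treeSum, map_sum, sum_mul_sum, VLin_tree, tree_mul_V]

theorem treeCoactionLin_treeSum_succ (n : ℕ) :
    treeCoactionLin (treeSum (n + 1)) = ∑ x ∈ antidiagonal n,
      treeComulHom (treeSum x.1) * VTensorId (treeCoactionLin (treeSum x.2)) := by
  simp only [treeSum_succ, map_sum, treeCoactionLin_mul_VLin]

theorem treeComulHom_treeSum_succ (n : ℕ) :
    treeComulHom (treeSum (n + 1)) = treeCoactionLin (treeSum (n + 1)) +
      ∑ x ∈ antidiagonal n, treeComulHom (treeSum x.1) * (1 ⊗ₜ VLin (treeSum x.2)) := by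
  simp only [treeSum_succ, map_sum, map_mul, treeComulHom_VLin, treeCoactionLin_mul_VLin, mul_add,
    sum_add_distrib, add_comm]

theorem underComulLin_treeSum_succ (n : ℕ) :
    underComulLin (treeSum (n + 1)) = 1 ⊗ₜ treeSum (n + 1) + ∑ x ∈ antidiagonal n,
      (treeSum x.1 ⊗ₜ 1) * VTensorId (underComulLin (treeSum x.2)) := by
  simp only [treeSum_succ, map_sum, underComulLin_mul_VLin, sum_add_distrib,
    TensorProduct.tmul_sum]

theorem underComulLin_treeSum (n : ℕ) :
    underComulLin (treeSum n) = ∑ x ∈ antidiagonal n, treeSum x.1 ⊗ₜ treeSum x.2 := by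
  induction n using Nat.strong_induction_on with
  | _ n ih =>
    rcases n with _ | n
    · rw [treeSum_zero, underComulLin_one, Nat.antidiagonal_zero, sum_singleton, treeSum_zero]
      rfl
    rw [underComulLin_treeSum_succ, Nat.sum_antidiagonal_succ, treeSum_zero]
    congr 1
    calc ∑ x ∈ antidiagonal n, (treeSum x.1 ⊗ₜ 1) * VTensorId (underComulLin (treeSum x.2))
      _ = ∑ x ∈ antidiagonal n, ∑ y ∈ antidiagonal x.2,
            (treeSum x.1 * VLin (treeSum y.1)) ⊗ₜ treeSum y.2 := by
        refine sum_congr rfl fun x hx => ?_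
        rw [ih x.2 (Nat.antidiagonal.snd_lt hx), map_sum, mul_sum]
        simp only [VTensorId_tmul, tmul_mul_tmul, one_mul]
      _ = ∑ x ∈ antidiagonal n, ∑ y ∈ antidiagonal x.1,
            (treeSum y.1 * VLin (treeSum y.2)) ⊗ₜ treeSum x.2 :=
        (sum_antidiagonal_assoc n fun i j k =>
          (treeSum i * VLin (treeSum j)) ⊗ₜ treeSum k).symm
      _ = ∑ x ∈ antidiagonal n, treeSum (x.1 + 1) ⊗ₜ treeSum x.2 := by
        simp only [treeSum_succ, TensorProduct.sum_tmul]

/-- The generating series `T(x) = ∑ t_n x^n` of the sums of trees. -/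
def treeSeries : PowerSeries TreeAlg := PowerSeries.mk treeSum

theorem treeSeries_eq : treeSeries = 1 + PowerSeries.X *
    (treeSeries * PowerSeries.mk fun n => VLin (treeSum n)) := by
  ext n
  rcases n with _ | n
  · simp [treeSeries, treeSum_zero]
  · rw [map_add, PowerSeries.coeff_succ_X_mul, PowerSeries.coeff_mul, PowerSeries.coeff_one,
      if_neg n.succ_ne_zero, zero_add, treeSeries]
    simp only [PowerSeries.coeff_mk, treeSum_succ]

theorem coeff_zero_treeSeries_pow (k : ℕ) : PowerSeries.coeff 0 (treeSeries ^ k) = 1 := by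
  simp [treeSeries, treeSum_zero]

theorem coeff_succ_treeSeries_pow_succ (k n : ℕ) :
    PowerSeries.coeff (n + 1) (treeSeries ^ (k + 1)) =
      PowerSeries.coeff (n + 1) (treeSeries ^ k) + ∑ x ∈ antidiagonal n,
        PowerSeries.coeff x.1 (treeSeries ^ (k + 1)) * VLin (treeSum x.2) := by
  have hpow : treeSeries ^ (k + 1) = treeSeries ^ k + PowerSeries.X *
      (treeSeries ^ (k + 1) * PowerSeries.mk fun n => VLin (treeSum n)) := by
    conv_lhs => rw [pow_succ, treeSeries_eq, mul_add, mul_one, ← treeSeries_eq]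
    rw [pow_succ, ← mul_assoc (treeSeries ^ k), (PowerSeries.commute_X (treeSeries ^ k)).eq]
    simp only [mul_assoc]
  conv_lhs => rw [hpow, map_add, PowerSeries.coeff_succ_X_mul, PowerSeries.coeff_mul]
  simp only [PowerSeries.coeff_mk]

/-- The coefficient of `x^n` in `∑_k t_k x^k ⊗ T(x)^{k+c}`, which describes the co-action for
`c = 0` and the co-product for `c = 1`. -/
def substCoeff (c n : ℕ) : TreeAlg ⊗[ℂ] TreeAlg :=
  ∑ x ∈ antidiagonal n, treeSum x.1 ⊗ₜ PowerSeries.coeff x.2 (treeSeries ^ (x.1 + c))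

theorem substCoeff_zero (c : ℕ) : substCoeff c 0 = 1 := by
  rw [substCoeff, Nat.antidiagonal_zero, sum_singleton, treeSum_zero, coeff_zero_treeSeries_pow]
  rfl

theorem substCoeff_zero_succ (n : ℕ) : substCoeff 0 (n + 1) =
    ∑ x ∈ antidiagonal n, substCoeff 1 x.1 * VTensorId (substCoeff 0 x.2) := by
  have hpow (k l : ℕ) : treeSeries ^ (k + 1) * treeSeries ^ l = treeSeries ^ (k + l + 1) := by
    rw [← pow_add, add_right_comm]
  symm
  calc ∑ x ∈ antidiagonal n, substCoeff 1 x.1 * VTensorId (substCoeff 0 x.2)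
    _ = ∑ x ∈ antidiagonal n, ∑ y ∈ antidiagonal x.1, ∑ z ∈ antidiagonal x.2,
          (treeSum y.1 * VLin (treeSum z.1)) ⊗ₜ (PowerSeries.coeff y.2 (treeSeries ^ (y.1 + 1)) *
            PowerSeries.coeff z.2 (treeSeries ^ z.1)) := by
      simp only [substCoeff, map_sum, sum_mul_sum, VTensorId_tmul, tmul_mul_tmul, add_zero]
    _ = ∑ x ∈ antidiagonal n, ∑ y ∈ antidiagonal x.1, ∑ z ∈ antidiagonal x.2,
          (treeSum y.1 * VLin (treeSum y.2)) ⊗ₜ (PowerSeries.coeff z.1 (treeSeries ^ (y.1 + 1)) *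
            PowerSeries.coeff z.2 (treeSeries ^ y.2)) :=
      sum_antidiagonal_exchange n fun k p l q => (treeSum k * VLin (treeSum l)) ⊗ₜ[ℂ]
        (PowerSeries.coeff p (treeSeries ^ (k + 1)) * PowerSeries.coeff q (treeSeries ^ l))
    _ = ∑ x ∈ antidiagonal n,
          treeSum (x.1 + 1) ⊗ₜ PowerSeries.coeff x.2 (treeSeries ^ (x.1 + 1)) := by
      refine sum_congr rfl fun x _ => ?_
      rw [treeSum_succ, TensorProduct.sum_tmul]
      refine sum_congr rfl fun y hy => ?_
      rw [← TensorProduct.tmul_sum, ← PowerSeries.coeff_mul, hpow, mem_antidiagonal.1 hy]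
    _ = substCoeff 0 (n + 1) := by
      rw [substCoeff, Nat.sum_antidiagonal_succ, pow_zero, PowerSeries.coeff_one,
        if_neg n.succ_ne_zero, TensorProduct.tmul_zero, zero_add]

theorem substCoeff_one_succ (n : ℕ) : substCoeff 1 (n + 1) = substCoeff 0 (n + 1) +
    ∑ x ∈ antidiagonal n, substCoeff 1 x.1 * (1 ⊗ₜ VLin (treeSum x.2)) := by
  have hassoc : ∑ x ∈ antidiagonal n, substCoeff 1 x.1 * (1 ⊗ₜ VLin (treeSum x.2)) =
      ∑ x ∈ antidiagonal n, ∑ y ∈ antidiagonal x.2, treeSum x.1 ⊗ₜ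
        (PowerSeries.coeff y.1 (treeSeries ^ (x.1 + 1)) * VLin (treeSum y.2)) := by
    rw [← sum_antidiagonal_assoc n fun k p j => treeSum k ⊗ₜ[ℂ]
      (PowerSeries.coeff p (treeSeries ^ (k + 1)) * VLin (treeSum j))]
    simp only [substCoeff, sum_mul, tmul_mul_tmul, mul_one]
  rw [hassoc, substCoeff, substCoeff, Nat.sum_antidiagonal_succ', Nat.sum_antidiagonal_succ',
    add_assoc _ (Finset.sum _ _), ← sum_add_distrib]
  simp only [coeff_zero_treeSeries_pow, coeff_succ_treeSeries_pow_succ, TensorProduct.tmul_add,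
    TensorProduct.tmul_sum, add_zero]

theorem treeCoactionLin_and_treeComulHom_treeSum (n : ℕ) :
    treeCoactionLin (treeSum n) = substCoeff 0 n ∧ treeComulHom (treeSum n) = substCoeff 1 n := by
  induction n using Nat.strong_induction_on with
  | _ n ih =>
    rcases n with _ | n
    · rw [treeSum_zero, substCoeff_zero, substCoeff_zero]
      exact ⟨treeCoactionLin_tree .nil, map_one treeComulHom⟩
    have hδ : treeCoactionLin (treeSum (n + 1)) = substCoeff 0 (n + 1) := by
      rw [treeCoactionLin_treeSum_succ, substCoeff_zero_succ]
      refine sum_congr rfl fun x hx => ?_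
      rw [(ih _ (Nat.antidiagonal.fst_lt hx)).2, (ih _ (Nat.antidiagonal.snd_lt hx)).1]
    refine ⟨hδ, ?_⟩
    rw [treeComulHom_treeSum_succ, substCoeff_one_succ, hδ]
    congr 1
    refine sum_congr rfl fun x hx => ?_
    rw [(ih _ (Nat.antidiagonal.fst_lt hx)).2]

end TreeSums

/-! ### The embeddings `Ω` and `j` -/

section Embeddings

open Finset Algebra.TensorProduct

theorem cgdif_hom_ext {A : Type*} [CommSemiring A] [Algebra ℂ A] {f g : CGdif →ₐ[ℂ] A}
    (h : ∀ n, f (a (n + 1)) = g (a (n + 1))) : f = g :=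
  MvPolynomial.algHom_ext h

theorem hinv_hom_ext {A : Type*} [Semiring A] [Algebra ℂ A] {f g : Hinv →ₐ[ℂ] A}
    (h : ∀ n, f (b (n + 1)) = g (b (n + 1))) : f = g :=
  FreeAlgebra.hom_ext (funext h)

theorem coeff_seriesA_pow (k p : ℕ) :
    PowerSeries.coeff (p + k) (seriesA ^ k) = PowerSeries.coeff p (PowerSeries.mk a ^ k) := by
  rw [seriesA, mul_pow, PowerSeries.coeff_X_pow_mul]

theorem difComul_a_succ (n : ℕ) : difComul (a (n + 1)) = ∑ x ∈ antidiagonal (n + 1),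
    a x.1 ⊗ₜ PowerSeries.coeff x.2 (PowerSeries.mk a ^ (x.1 + 1)) := by
  rw [a, difComul, MvPolynomial.aeval_X, Nat.sum_antidiagonal_eq_sum_range_succ_mk]
  refine sum_congr rfl fun k hk => ?_
  rw [← coeff_seriesA_pow, ← add_assoc, Nat.sub_add_cancel (mem_range_succ_iff.1 hk)]

theorem invComul_b_succ (n : ℕ) :
    invComul (b (n + 1)) = ∑ x ∈ antidiagonal (n + 1), b x.1 ⊗ₜ b x.2 := by
  rw [b, invComul, FreeAlgebra.lift_ι_apply, Nat.sum_antidiagonal_eq_sum_range_succ_mk]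

theorem difCoaction_b_succ (n : ℕ) : difCoaction (b (n + 1)) = ∑ x ∈ antidiagonal (n + 1),
    b x.1 ⊗ₜ PowerSeries.coeff x.2 (PowerSeries.mk a ^ x.1) := by
  rw [b, difCoaction, FreeAlgebra.lift_ι_apply, Nat.sum_antidiagonal_eq_sum_range_succ_mk]
  refine sum_congr rfl fun k hk => ?_
  rw [← coeff_seriesA_pow, Nat.sub_add_cancel (mem_range_succ_iff.1 hk)]

/-- The embedding `Ω : ℂ(G^dif) → H^α`, `a_n ↦ t_n`. -/
def omegaHom : CGdif →ₐ[ℂ] Halpha := MvPolynomial.aeval fun n => toHalpha (treeSum (n + 1))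

theorem omegaHom_a (n : ℕ) : omegaHom (a n) = toHalpha (treeSum n) := by
  cases n with
  | zero => rw [a, treeSum_zero, map_one, map_one]
  | succ n => rw [a, omegaHom, MvPolynomial.aeval_X]

/-- The embedding `j : H^inv → H^e`, `b_n ↦ t_n`. -/
def jHom : Hinv →ₐ[ℂ] He := FreeAlgebra.lift ℂ fun n => toHe (treeSum (n + 1))

theorem jHom_b (n : ℕ) : jHom (b n) = toHe (treeSum n) := by
  cases n with
  | zero => rw [b, treeSum_zero, map_one, toHe_one]
  | succ n => rw [b, jHom, FreeAlgebra.lift_ι_apply]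

theorem omegaHom_coeff_mk_a_pow (k p : ℕ) :
    omegaHom (PowerSeries.coeff p (PowerSeries.mk a ^ k)) =
      toHalpha (PowerSeries.coeff p (treeSeries ^ k)) := by
  have hmap : PowerSeries.map (omegaHom : CGdif →+* Halpha) (PowerSeries.mk a) =
      PowerSeries.map (toHalpha : TreeAlg →+* Halpha) treeSeries := by
    ext1 n
    rw [PowerSeries.coeff_map, PowerSeries.coeff_map, treeSeries, PowerSeries.coeff_mk,
      PowerSeries.coeff_mk]
    exact omegaHom_a n
  calc omegaHom (PowerSeries.coeff p (PowerSeries.mk a ^ k))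
    _ = PowerSeries.coeff p (PowerSeries.map (omegaHom : CGdif →+* Halpha)
          (PowerSeries.mk a) ^ k) := by rw [← map_pow, PowerSeries.coeff_map]; rfl
    _ = toHalpha (PowerSeries.coeff p (treeSeries ^ k)) := by
      rw [hmap, ← map_pow, PowerSeries.coeff_map]; rfl

theorem alphaComul_comp_omegaHom :
    alphaComul.comp omegaHom = (map omegaHom omegaHom).comp difComul := by
  refine cgdif_hom_ext fun n => ?_
  calc alphaComul (omegaHom (a (n + 1)))
    _ = map toHalpha toHalpha (treeComulHom (treeSum (n + 1))) := by
      rw [omegaHom_a]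
      exact DFunLike.congr_fun alphaComul_comp_toHalpha _
    _ = map omegaHom omegaHom (difComul (a (n + 1))) := by
      rw [(treeCoactionLin_and_treeComulHom_treeSum _).2, substCoeff, difComul_a_succ]
      simp only [map_sum, map_tmul, omegaHom_a, omegaHom_coeff_mk_a_pow]

theorem eComul_comp_jHom : eComul.comp jHom = (map jHom jHom).comp invComul := by
  refine hinv_hom_ext fun n => ?_
  calc eComul (jHom (b (n + 1)))
    _ = TensorProduct.map toHe toHe (underComulLin (treeSum (n + 1))) := by
      rw [jHom_b]
      exact DFunLike.congr_fun eComul_comp_toHe _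
    _ = map jHom jHom (invComul (b (n + 1))) := by
      rw [underComulLin_treeSum, invComul_b_succ]
      simp only [map_sum, TensorProduct.map_tmul, map_tmul, jHom_b]

theorem eCoaction_comp_jHom : eCoaction.comp jHom = (map jHom omegaHom).comp difCoaction := by
  refine hinv_hom_ext fun n => ?_
  calc eCoaction (jHom (b (n + 1)))
    _ = TensorProduct.map toHe toHalpha.toLinearMap (treeCoactionLin (treeSum (n + 1))) := by
      rw [jHom_b]
      exact DFunLike.congr_fun eCoaction_comp_toHe _
    _ = map jHom omegaHom (difCoaction (b (n + 1))) := by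
      rw [(treeCoactionLin_and_treeComulHom_treeSum _).1, substCoeff, difCoaction_b_succ]
      simp only [map_sum, TensorProduct.map_tmul, map_tmul, jHom_b, omegaHom_coeff_mk_a_pow,
        AlgHom.toLinearMap_apply, add_zero]

theorem treeCounit_treeSum_succ (n : ℕ) : treeCounit (treeSum (n + 1)) = 0 := by
  have hV (x : TreeAlg) : treeCounit (VLin x) = 0 := DFunLike.congr_fun treeCounit_comp_VLin x
  simp only [treeSum_succ, map_sum, map_mul, hV, mul_zero, sum_const_zero]

theorem alphaCounit_comp_omegaHom : alphaCounit.comp omegaHom = difCounit := by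
  refine cgdif_hom_ext fun n => ?_
  calc alphaCounit (omegaHom (a (n + 1)))
    _ = treeCounit (treeSum (n + 1)) := by rw [omegaHom_a]; rfl
    _ = difCounit (a (n + 1)) := by
      rw [treeCounit_treeSum_succ, a, difCounit, MvPolynomial.aeval_X]

theorem eCounit_comp_jHom : eCounit.comp jHom = invCounit := by
  refine hinv_hom_ext fun n => ?_
  calc eCounit (jHom (b (n + 1)))
    _ = treeCounit (treeSum (n + 1)) := by
      rw [jHom_b]
      exact DFunLike.congr_fun eCounit_comp_toHe _
    _ = invCounit (b (n + 1)) := by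
      rw [treeCounit_treeSum_succ, b, invCounit, FreeAlgebra.lift_ι_apply]

/-- The right comb with `n` internal vertices. The left inverses of `Ω` and `j` only see the
combs, one in each `t_n`. -/
def comb : ℕ → PBT
  | 0 => .nil
  | n + 1 => V (comb n)

theorem numNodes_comb (n : ℕ) : (comb n).numNodes = n := by
  induction n with
  | zero => rfl
  | succ n ih => rw [comb, V, BinaryTree.numNodes, BinaryTree.numNodes, ih, zero_add]

/-- The function on trees with value `f n` at the comb with `n` internal vertices, and zero at the
other trees. -/
def onCombs {M : Type*} [Zero M] (f : ℕ → M) (t : PBT) : M :=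
  if t = comb t.numNodes then f t.numNodes else 0

theorem sum_onCombs {M : Type*} [AddCommMonoid M] (f : ℕ → M) (n : ℕ) :
    ∑ t ∈ BinaryTree.treesOfNumNodesEq n, onCombs f t = f n := by
  rw [sum_eq_single (comb n)]
  · rw [onCombs, numNodes_comb, if_pos rfl]
  · intro t ht hne
    rw [onCombs, BinaryTree.mem_treesOfNumNodesEq.1 ht, if_neg hne]
  · exact fun hn => absurd (BinaryTree.mem_treesOfNumNodesEq.2 (numNodes_comb n)) hn

/-- The series `v(x)` with `a(x) = 1 + x a(x) v(x)`, where `a(x) = ∑ a_n x^n`; its coefficients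
are the values on the `V(t_n)` of a left inverse of `Ω`. -/
def vSeries : PowerSeries CGdif :=
  PowerSeries.invOfUnit (PowerSeries.mk a) 1 * PowerSeries.mk fun n => a (n + 1)

theorem a_succ (n : ℕ) :
    a (n + 1) = ∑ x ∈ antidiagonal n, a x.1 * PowerSeries.coeff x.2 vSeries := by
  have hmul : PowerSeries.mk a * vSeries = PowerSeries.mk fun n => a (n + 1) := by
    rw [vSeries, ← mul_assoc, PowerSeries.mul_invOfUnit, one_mul]
    rw [← PowerSeries.coeff_zero_eq_constantCoeff_apply, PowerSeries.coeff_mk]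
    rfl
  calc a (n + 1)
    _ = PowerSeries.coeff n (PowerSeries.mk a * vSeries) := by rw [hmul, PowerSeries.coeff_mk]
    _ = _ := by simp only [PowerSeries.coeff_mul, PowerSeries.coeff_mk]

/-- A left inverse of `Ω`. -/
def omegaInv : Halpha →ₐ[ℂ] CGdif :=
  MvPolynomial.aeval (onCombs fun n => PowerSeries.coeff n vSeries)

theorem omegaInv_toHalpha_VLin_treeSum (n : ℕ) :
    omegaInv (toHalpha (VLin (treeSum n))) = PowerSeries.coeff n vSeries := by
  simp only [treeSum, map_sum, VLin_tree, toHalpha_tree_V, omegaInv, MvPolynomial.aeval_X,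
    sum_onCombs]

theorem omegaInv_toHalpha_treeSum (n : ℕ) : omegaInv (toHalpha (treeSum n)) = a n := by
  induction n using Nat.strong_induction_on with
  | _ n ih =>
    rcases n with _ | n
    · rw [treeSum_zero, map_one, map_one, a]
    rw [treeSum_succ, map_sum, map_sum, a_succ]
    refine sum_congr rfl fun x hx => ?_
    rw [map_mul, map_mul, ih x.1 (Nat.antidiagonal.fst_lt hx), omegaInv_toHalpha_VLin_treeSum]

theorem injective_omegaHom : Injective omegaHom := by
  have hinv : omegaInv.comp omegaHom = AlgHom.id ℂ CGdif := cgdif_hom_ext fun n => by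
    rw [AlgHom.comp_apply, omegaHom_a, omegaInv_toHalpha_treeSum, AlgHom.id_apply]
  exact LeftInverse.injective (g := omegaInv) (DFunLike.congr_fun hinv)

/-- A left inverse of `j`. -/
def jInv : He →ₐ[ℂ] Hinv := FreeAlgebra.lift ℂ fun t => onCombs b t.1

theorem jInv_toHe_tree (t : PBT) : jInv (toHe (tree t)) = onCombs b t := by
  rw [toHe_tree]
  cases t with
  | nil => rw [treeGen, map_one]; rfl
  | node _ r s => rw [treeGen, jInv, FreeAlgebra.lift_ι_apply]

theorem injective_jHom : Injective jHom := by
  have hinv : jInv.comp jHom = AlgHom.id ℂ Hinv := hinv_hom_ext fun n => by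
    rw [AlgHom.comp_apply, jHom_b, AlgHom.id_apply]
    simp only [treeSum, map_sum, jInv_toHe_tree, sum_onCombs]
  exact LeftInverse.injective (g := jInv) (DFunLike.congr_fun hinv)

end Embeddings

section Series

/-- The embedding `Ω ⊗ j` of `ℂ(G^dif) ⋉ H^inv` in `H^α ⋉ H^e`. -/
def seriesToQED : SeriesSmash →ₐ[ℂ] QEDSmash := Algebra.TensorProduct.map omegaHom jHom

theorem qedComul_comp_seriesToQED : qedComul.comp seriesToQED =
    (Algebra.TensorProduct.map seriesToQED seriesToQED).comp seriesComul :=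
  smashComul_comp_map alphaComul_comp_omegaHom eComul_comp_jHom eCoaction_comp_jHom

theorem qedCounit_comp_seriesToQED : qedCounit.comp seriesToQED = seriesCounit :=
  smashCounit_comp_map alphaCounit_comp_omegaHom eCounit_comp_jHom

theorem injective_seriesToQED : Injective seriesToQED :=
  TensorProduct.map_injective_of_flat_flat omegaHom.toLinearMap jHom.toLinearMap
    injective_omegaHom injective_jHom

theorem isBialgebra_series : IsBialgebra seriesComul seriesCounit :=
  isBialgebra_qed.of_injective seriesToQED injective_seriesToQED qedComul_comp_seriesToQED
    qedCounit_comp_seriesToQED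

theorem isHopf_series : IsHopf seriesComul seriesCounit := by
  refine isBialgebra_series.isHopf ?_
  let := isBialgebra_series.bialgebra
  let := isBialgebra_qed.bialgebra
  exact isConilpotent_qed.of_injective (BialgHom.ofAlgHom seriesToQED qedCounit_comp_seriesToQED
    qedComul_comp_seriesToQED.symm) injective_seriesToQED

end Series

end QEDHopf

end

theorem corollary4p3 :
    ∃ (Ω : QEDHopf.CGdif →ₐ[ℂ] QEDHopf.Halpha) (j : QEDHopf.Hinv →ₐ[ℂ] QEDHopf.He),
      -- the embeddings of the two factors, which respect co-products and co-units
      (∀ n : ℕ, Ω (QEDHopf.a n) = QEDHopf.toHalpha (QEDHopf.treeSum n)) ∧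
      (∀ n : ℕ, j (QEDHopf.b n) = QEDHopf.toHe (QEDHopf.treeSum n)) ∧
      Function.Injective Ω ∧ Function.Injective j ∧
      QEDHopf.alphaComul.comp Ω = (Algebra.TensorProduct.map Ω Ω).comp QEDHopf.difComul ∧
      QEDHopf.alphaCounit.comp Ω = QEDHopf.difCounit ∧
      QEDHopf.eComul.comp j = (Algebra.TensorProduct.map j j).comp QEDHopf.invComul ∧
      QEDHopf.eCounit.comp j = QEDHopf.invCounit ∧
      -- they are compatible with the co-actions
      QEDHopf.eCoaction.comp j = (Algebra.TensorProduct.map j Ω).comp QEDHopf.difCoaction ∧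
      -- the two semi-direct co-products are Hopf algebras, and `Ω ⊗ j` embeds one in the other
      ∃ (hser : QEDHopf.IsHopf QEDHopf.seriesComul QEDHopf.seriesCounit)
        (hqed : QEDHopf.IsHopf QEDHopf.qedComul QEDHopf.qedCounit),
        letI : HopfAlgebra ℂ QEDHopf.SeriesSmash := hser.hopfAlgebra
        letI : HopfAlgebra ℂ QEDHopf.QEDSmash := hqed.hopfAlgebra
        ∃ Φ : QEDHopf.SeriesSmash →ₐc[ℂ] QEDHopf.QEDSmash,
          (∀ (x : QEDHopf.CGdif) (y : QEDHopf.Hinv), Φ (x ⊗ₜ[ℂ] y) = Ω x ⊗ₜ[ℂ] j y) ∧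
          Function.Injective Φ ∧
          ∀ x : QEDHopf.SeriesSmash,
            Φ (HopfAlgebra.antipode ℂ x) = HopfAlgebra.antipode ℂ (Φ x) := by
  refine ⟨QEDHopf.omegaHom, QEDHopf.jHom, QEDHopf.omegaHom_a, QEDHopf.jHom_b,
    QEDHopf.injective_omegaHom, QEDHopf.injective_jHom, QEDHopf.alphaComul_comp_omegaHom,
    QEDHopf.alphaCounit_comp_omegaHom, QEDHopf.eComul_comp_jHom, QEDHopf.eCounit_comp_jHom,
    QEDHopf.eCoaction_comp_jHom, QEDHopf.isHopf_series, QEDHopf.isHopf_qed, ?_⟩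
  let : HopfAlgebra ℂ QEDHopf.SeriesSmash := QEDHopf.isHopf_series.hopfAlgebra
  let : HopfAlgebra ℂ QEDHopf.QEDSmash := QEDHopf.isHopf_qed.hopfAlgebra
  let Φ : QEDHopf.SeriesSmash →ₐc[ℂ] QEDHopf.QEDSmash :=
    BialgHom.ofAlgHom QEDHopf.seriesToQED QEDHopf.qedCounit_comp_seriesToQED
      QEDHopf.qedComul_comp_seriesToQED.symm
  exact ⟨Φ, fun _ _ => rfl, QEDHopf.injective_seriesToQED, QEDHopf.map_antipode Φ⟩
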